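/- For a finite graph $G=(V,E)$ and an initial configuration $S_0:V\to\{-1,+1\}$, majority dynamics is the process defined for $t\ge 0$ and $v\in V$ by $$S_{t+1}(v)=\begin{cases}\operatorname{sgn}\Bigl(\sum_{u\in N(v)}S_t(u)\Bigr)&\text{if }\sum_{u\in N(v)}S_t(u)\neq 0,\\ S_t(v)&\text{otherwise,}\end{cases}$$ where $N(v)$ is the set of neighbours of $v$ in $G$, and $\operatorname{sgn}(x)=-1$ if $x<0$, $\operatorname{sgn}(x)=+1$ if $x>0$. Let $G(n,p)$ be the random graph on $V_n=\{1,\dots,n\}$ in which every pair of distinct vertices is an edge with probability $p$, independently of all other pairs. **Theorem.** For every $0<\varepsilon\le 1$ there exist $\lambda>0$ and $n_0$ such that for all $n>n_0$ and all $p\in[0,1]$ with $p\ge\lambda n^{-1/2}$ the following holds. Let $G$ be distributed as $G(n,p)$ and let $S_0$ be uniformly distributed on $\{-1,+1\}^{V_n}$, independently of $G$. Then with probability at least $1-\varepsilon$ (over the joint choice of $G$ and $S_0$) we have $\sum_{v\in V_n}S_0(v)\ne 0$ and $$S_4(u)=\operatorname{sgn}\Bigl(\sum_{v\in V_n}S_0(v)\Bigr)\quad\text{for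 every }u\in V_n .$$ -/

import Mathlib

namespace MajorityDynamics

/-- The sign of a nonzero integer, as an element of `{-1, +1}`. The value at `0` is immaterial:
`sgn` is only ever used below at arguments that are required to be nonzero. -/
def sgn (x : ℤ) : ℤˣ := if x < 0 then -1 else 1

open scoped Classical in
/-- One synchronous round of majority dynamics on the graph `G`. A configuration assigns to each
vertex a state in `ℤˣ = {-1, +1}`; every vertex adopts the majority of the states of its
neighbours and keeps its own state in the case of a tie. -/
noncomputable def step {V : Type*} [Fintype V] (G : SimpleGraph V) (S : V → ℤˣ) : V → ℤˣ :=
  fun v =>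
    if ∑ u ∈ G.neighborFinset v, (S u : ℤ) ≠ 0 then
      sgn (∑ u ∈ G.neighborFinset v, (S u : ℤ))
    else S v

/-- The configuration `S_t` after `t` rounds, started from `S_0 = S`. -/
noncomputable def state {V : Type*} [Fintype V] (G : SimpleGraph V) (S : V → ℤˣ) (t : ℕ) :
    V → ℤˣ :=
  (step G)^[t] S

/-- The law of the pair (random graph, initial configuration) on the vertex set `Fin n`: the graph
is the binomial random graph `G(n, p)` and, independently of it, the initial configuration is
uniform on `{-1, +1}^n`, that is, the initial states are independent and uniform. -/
noncomputable def law (n : ℕ) (p : unitInterval) :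
    MeasureTheory.Measure (SimpleGraph (Fin n) × (Fin n → ℤˣ)) :=
  (SimpleGraph.binomialRandom (Fin n) p).prod
    (ProbabilityTheory.uniformOn (Set.univ : Set (Fin n → ℤˣ)))

/-- The event that the initial configuration has a strict majority and that all vertices hold the
initial majority state after `t` rounds. -/
def unanimous (n t : ℕ) : Set (SimpleGraph (Fin n) × (Fin n → ℤˣ)) :=
  {ω | ∑ v, (ω.2 v : ℤ) ≠ 0 ∧ ∀ v, state ω.1 ω.2 t v = sgn (∑ u, (ω.2 u : ℤ))}

end MajorityDynamics

/-! Let D be the sum of the initial states. It is typically of order √n, and by the symmetry of the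
two signs D may be taken positive. The initial configuration σ is then fixed, and only the graph is
random.

Round one. The neighbour sum at a vertex is a sum of independent terms in which potential plus edges
outnumber potential minus edges by about D. Pairing plus with minus leaves a lazy symmetric walk of
standard deviation at most of order √(pn), and the surplus pushes it up by about pD. Since |D| is at
least about c√n, every vertex acquires a bias of at least c√p/96 (`bias_ge`).

Round two. Fix v and ignore the edges at v when evaluating the states of the other vertices after
round one. Two such states share only one edge, whose influence on either of them is at most of
order 1/√(p(1-p)n). Their covariance is therefore O(1/n), uniformly in p
(`expect_decoupled_mul_sub_le`). The neighbour sum at v is thus bounded below by a variable of mean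
at least of order c·p^(3/2)·n and variance O(pn). Chebyshev bounds the failure probability by
O(1/(c²p²n)) (`expect_second_round_le`), and this is where p ≥ λ/√n is needed. By Markov, at most
n/8 vertices are then wrong, except with small probability.

Rounds three and four use only pseudo-randomness of the graph (`state_four_eq_one`), so dependence
on the past does not matter. A union bound over at most 4^n pairs shows that for every configuration
with at most n/8 minus signs, every set of b ≈ 64/p vertices has a positive total neighbour sum. So
fewer than b vertices are wrong after round three. All degrees exceed 2b, so these cannot outvote
anybody in round four. -/

namespace MajorityDynamics

/-! ### Averaging operators on functions on ℤ. -/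

/-- Averaging against a `{0, 1}`-valued step that equals `1` with probability `p`. -/
def up (p : ℝ) : Module.End ℝ (ℤ → ℝ) where
  toFun φ x := p * φ (x + 1) + (1 - p) * φ x
  map_add' φ χ := by ext x; simp; ring
  map_smul' r φ := by ext x; simp; ring

/-- Averaging against a `{0, -1}`-valued step that equals `-1` with probability `p`. -/
def down (p : ℝ) : Module.End ℝ (ℤ → ℝ) where
  toFun φ x := p * φ (x - 1) + (1 - p) * φ x
  map_add' φ χ := by ext x; simp; ring
  map_smul' r φ := by ext x; simp; ring

/-- Averaging against a lazy symmetric step, equal to each of `±1` with probability `q`. -/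
def lazyStep (q : ℝ) : Module.End ℝ (ℤ → ℝ) where
  toFun φ x := q * φ (x + 1) + q * φ (x - 1) + (1 - 2 * q) * φ x
  map_add' φ χ := by ext x; simp; ring
  map_smul' r φ := by ext x; simp; ring

/-- Translation of functions on `ℤ`. -/
def shift (k : ℤ) : Module.End ℝ (ℤ → ℝ) where
  toFun φ x := φ (x + k)
  map_add' φ χ := by ext x; simp
  map_smul' r φ := by ext x; simp

/-- The indicator function of a single integer. -/
def point (k : ℤ) : ℤ → ℝ := fun x => if x = k then 1 else 0

theorem up_apply (p : ℝ) (φ : ℤ → ℝ) (x : ℤ) : up p φ x = p * φ (x + 1) + (1 - p) * φ x := rfl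

theorem down_apply (p : ℝ) (φ : ℤ → ℝ) (x : ℤ) :
    down p φ x = p * φ (x - 1) + (1 - p) * φ x := rfl

theorem lazyStep_apply (q : ℝ) (φ : ℤ → ℝ) (x : ℤ) :
    lazyStep q φ x = q * φ (x + 1) + q * φ (x - 1) + (1 - 2 * q) * φ x := rfl

theorem shift_apply (k : ℤ) (φ : ℤ → ℝ) (x : ℤ) : shift k φ x = φ (x + k) := rfl

/-- A plus edge and a minus edge, present independently with the same probability, combine into one
lazy symmetric step. This pairing underlies the walk estimates below. -/
theorem up_mul_down (p : ℝ) : up p * down p = lazyStep (p * (1 - p)) := by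
  ext φ x
  simp only [Module.End.mul_apply, up_apply, down_apply, lazyStep_apply, add_sub_cancel_right]
  ring

theorem commute_up_down (p r : ℝ) : Commute (up p) (down r) := by
  ext φ x
  simp only [Module.End.mul_apply, up_apply, down_apply, add_sub_cancel_right, sub_add_cancel]
  ring

theorem commute_up_shift (p : ℝ) (k : ℤ) : Commute (up p) (shift k) := by
  ext φ x
  simp only [Module.End.mul_apply, up_apply, shift_apply, add_right_comm]

theorem commute_lazyStep_shift (q : ℝ) (k : ℤ) : Commute (lazyStep q) (shift k) := by
  ext φ x
  simp only [Module.End.mul_apply, lazyStep_apply, shift_apply, add_right_comm, sub_eq_add_neg]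

theorem up_pow_mul_down_pow (p : ℝ) (d m : ℕ) :
    up p ^ (m + d) * down p ^ m = up p ^ d * lazyStep (p * (1 - p)) ^ m := by
  rw [← up_mul_down, (commute_up_down p p).mul_pow, ← mul_assoc, ← pow_add, add_comm]

/-- An averaging operator: positivity preserving, and fixing the constants. -/
structure IsAveraging (T : Module.End ℝ (ℤ → ℝ)) : Prop where
  mono : ∀ φ χ : ℤ → ℝ, φ ≤ χ → T φ ≤ T χ
  const : ∀ r : ℝ, T (fun _ => r) = fun _ => r

theorem IsAveraging.mul {T T' : Module.End ℝ (ℤ → ℝ)} (h : IsAveraging T) (h' : IsAveraging T') :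
    IsAveraging (T * T') where
  mono φ χ H := h.mono _ _ (h'.mono _ _ H)
  const r := by rw [Module.End.mul_apply, h'.const, h.const]

theorem IsAveraging.pow {T : Module.End ℝ (ℤ → ℝ)} (h : IsAveraging T) (m : ℕ) :
    IsAveraging (T ^ m) := by
  induction m with
  | zero => exact ⟨fun φ χ H => H, fun r => rfl⟩
  | succ m ih => rw [pow_succ]; exact ih.mul h

theorem IsAveraging.le_of_le {T : Module.End ℝ (ℤ → ℝ)} (h : IsAveraging T) {φ : ℤ → ℝ} {r : ℝ}
    (H : ∀ x, φ x ≤ r) (x : ℤ) : T φ x ≤ r := by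
  have := h.mono φ (fun _ => r) H x
  rwa [h.const] at this

theorem IsAveraging.ge_of_ge {T : Module.End ℝ (ℤ → ℝ)} (h : IsAveraging T) {φ : ℤ → ℝ} {r : ℝ}
    (H : ∀ x, r ≤ φ x) (x : ℤ) : r ≤ T φ x := by
  have := h.mono (fun _ => r) φ H x
  rwa [h.const] at this

theorem isAveraging_up {p : ℝ} (h0 : 0 ≤ p) (h1 : p ≤ 1) : IsAveraging (up p) where
  mono φ χ H x := by
    have := mul_le_mul_of_nonneg_left (H (x + 1)) h0
    have := mul_le_mul_of_nonneg_left (H x) (sub_nonneg.2 h1)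
    simp only [up_apply]; linarith
  const r := by ext x; simp only [up_apply]; ring

theorem isAveraging_down {p : ℝ} (h0 : 0 ≤ p) (h1 : p ≤ 1) : IsAveraging (down p) where
  mono φ χ H x := by
    have := mul_le_mul_of_nonneg_left (H (x - 1)) h0
    have := mul_le_mul_of_nonneg_left (H x) (sub_nonneg.2 h1)
    simp only [down_apply]; linarith
  const r := by ext x; simp only [down_apply]; ring

theorem isAveraging_lazyStep {q : ℝ} (h0 : 0 ≤ q) (h1 : 2 * q ≤ 1) :
    IsAveraging (lazyStep q) where
  mono φ χ H x := by
    have := mul_le_mul_of_nonneg_left (H (x + 1)) h0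
    have := mul_le_mul_of_nonneg_left (H (x - 1)) h0
    have := mul_le_mul_of_nonneg_left (H x) (sub_nonneg.2 h1)
    simp only [lazyStep_apply]; linarith
  const r := by ext x; simp only [lazyStep_apply]; ring

/-! ### The lazy symmetric random walk -/

/-- The probability that the lazy symmetric walk moves from `x` to `0` in `m` steps. -/
noncomputable def lazyWalk (q : ℝ) (m : ℕ) (x : ℤ) : ℝ := (lazyStep q ^ m) (point 0) x

theorem lazyWalk_zero (q : ℝ) (x : ℤ) : lazyWalk q 0 x = point 0 x := rfl

theorem lazyWalk_succ (q : ℝ) (m : ℕ) (x : ℤ) :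
    lazyWalk q (m + 1) x = q * lazyWalk q m (x + 1) + q * lazyWalk q m (x - 1)
      + (1 - 2 * q) * lazyWalk q m x := by
  simp only [lazyWalk, pow_succ', Module.End.mul_apply, lazyStep_apply]

theorem lazyStep_pow_point (q : ℝ) (m : ℕ) (k x : ℤ) :
    (lazyStep q ^ m) (point k) x = lazyWalk q m (x - k) := by
  have h : point k = shift (-k) (point 0) := by
    ext y; simp only [point, shift_apply]; congr 1; apply propext; omega
  have := congrArg (fun T : Module.End ℝ (ℤ → ℝ) => T (point 0) x)
    ((commute_lazyStep_shift q (-k)).pow_left m).eq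
  simp only [Module.End.mul_apply] at this
  rw [h, this, shift_apply, lazyWalk, sub_eq_add_neg]

theorem lazyWalk_neg (q : ℝ) (m : ℕ) (x : ℤ) : lazyWalk q m (-x) = lazyWalk q m x := by
  induction m generalizing x with
  | zero => simp [lazyWalk_zero, point]
  | succ m ih =>
    rw [lazyWalk_succ, lazyWalk_succ, ih, ← ih (x + 1), ← ih (x - 1),
      show -(x + 1) = -x - 1 by ring, show -(x - 1) = -x + 1 by ring]
    ring

/-- Laziness removes the parity obstruction to unimodality. The critical place is k = 0, where the
new difference is q times the old one at 1 plus 1 - 3q times the old one at 0. -/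
theorem lazyWalk_antitone {q : ℝ} (h0 : 0 ≤ q) (h1 : 4 * q ≤ 1) (m : ℕ) (k : ℕ) :
    lazyWalk q m (k + 1) ≤ lazyWalk q m k := by
  induction m generalizing k with
  | zero =>
    simp only [lazyWalk_zero, point]
    split_ifs <;> first | omega | norm_num
  | succ m ih =>
    rw [lazyWalk_succ, lazyWalk_succ]
    have a := ih k
    have b := ih (k + 1)
    push_cast at b
    rcases k with _ | k
    · have e : lazyWalk q m ((0 : ℕ) - 1) = lazyWalk q m 1 := by
        rw [← lazyWalk_neg]; norm_num
      rw [e]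
      simp only [Nat.cast_zero, zero_add] at *
      rw [sub_self]
      nlinarith [mul_nonneg h0 (sub_nonneg.2 b), mul_nonneg (by linarith : 0 ≤ 1 - 3 * q) (sub_nonneg.2 a)]
    · have c := ih k
      push_cast at *
      simp only [add_sub_cancel_right] at *
      nlinarith [mul_nonneg h0 (sub_nonneg.2 b), mul_nonneg h0 (sub_nonneg.2 c),
        mul_nonneg (by linarith : 0 ≤ 1 - 2 * q) (sub_nonneg.2 a)]

theorem lazyWalk_antitone_nat {q : ℝ} (h0 : 0 ≤ q) (h1 : 4 * q ≤ 1) (m : ℕ) :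
    Antitone fun k : ℕ => lazyWalk q m k :=
  antitone_nat_of_succ_le fun k => by simpa using lazyWalk_antitone h0 h1 m k

theorem lazyWalk_le_zero {q : ℝ} (h0 : 0 ≤ q) (h1 : 4 * q ≤ 1) (m : ℕ) (x : ℤ) :
    lazyWalk q m x ≤ lazyWalk q m 0 := by
  have key (k : ℕ) : lazyWalk q m k ≤ lazyWalk q m 0 :=
    lazyWalk_antitone_nat h0 h1 m (Nat.zero_le k)
  obtain ⟨k, rfl | rfl⟩ := x.eq_nat_or_neg
  · exact key k
  · rw [lazyWalk_neg]; exact key k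

theorem lazyWalk_nonneg {q : ℝ} (h0 : 0 ≤ q) (h1 : 4 * q ≤ 1) (m : ℕ) (x : ℤ) :
    0 ≤ lazyWalk q m x :=
  ((isAveraging_lazyStep h0 (by linarith)).pow m).ge_of_ge
    (fun y => by unfold point; split_ifs <;> norm_num) x

theorem lazyWalk_zero_antitone {q : ℝ} (h0 : 0 ≤ q) (h1 : 4 * q ≤ 1) :
    Antitone fun m : ℕ => lazyWalk q m 0 := by
  refine antitone_nat_of_succ_le fun m => ?_
  rw [lazyWalk_succ]
  nlinarith [lazyWalk_le_zero h0 h1 m (0 + 1), lazyWalk_le_zero h0 h1 m (0 - 1)]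

/-- A discrete Tanaka formula: one step leaves |x| unchanged on average except at 0, where it adds
2q. The expected modulus therefore counts visits to 0. -/
theorem lazyStep_pow_abs (q : ℝ) (m : ℕ) :
    (lazyStep q ^ m) (fun x => |(x : ℝ)|) 0 = 2 * q * ∑ j ∈ Finset.range m, lazyWalk q j 0 := by
  induction m with
  | zero => simp
  | succ m ih =>
    have h : lazyStep q (fun x : ℤ => |(x : ℝ)|) = (fun x : ℤ => |(x : ℝ)|) + (2 * q) • point 0 := by
      ext x
      simp only [lazyStep_apply, Pi.add_apply, Pi.smul_apply, smul_eq_mul, point]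
      rcases lt_trichotomy x 0 with hx | rfl | hx
      · have : (x : ℝ) + 1 ≤ 0 := by exact_mod_cast hx
        push_cast
        rw [abs_of_nonpos this, abs_of_neg (by linarith : (x : ℝ) - 1 < 0),
          abs_of_neg (by linarith : (x : ℝ) < 0), if_neg hx.ne]
        ring
      · simp; ring
      · have : 0 ≤ (x : ℝ) - 1 := by rw [sub_nonneg]; exact_mod_cast hx
        push_cast
        rw [abs_of_nonneg this, abs_of_pos (by linarith : 0 < (x : ℝ) + 1),
          abs_of_pos (by linarith : 0 < (x : ℝ)), if_neg hx.ne']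
        ring
    rw [pow_succ, Module.End.mul_apply, h, map_add, map_smul, Pi.add_apply, ih,
      Finset.sum_range_succ, Pi.smul_apply, smul_eq_mul, lazyWalk]
    ring

theorem lazyStep_pow_sq (q : ℝ) (m : ℕ) (y : ℤ) :
    (lazyStep q ^ m) (fun x => ((x : ℝ) - y) ^ 2) y = 2 * q * m := by
  induction m with
  | zero => simp
  | succ m ih =>
    have h : lazyStep q (fun x : ℤ => ((x : ℝ) - y) ^ 2)
        = (fun x : ℤ => ((x : ℝ) - y) ^ 2) + (2 * q) • fun _ => (1 : ℝ) := by
      ext x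
      simp only [lazyStep_apply, Pi.add_apply, Pi.smul_apply, smul_eq_mul]
      push_cast; ring
    have hc (k : ℕ) : (lazyStep q ^ k) (fun _ => (1 : ℝ)) = fun _ => 1 := by
      induction k with
      | zero => rfl
      | succ k ih => rw [pow_succ, Module.End.mul_apply,
          show lazyStep q (fun _ => (1 : ℝ)) = fun _ => 1 by ext; simp only [lazyStep_apply]; ring, ih]
    rw [pow_succ, Module.End.mul_apply, h, map_add, map_smul, Pi.add_apply, ih, Pi.smul_apply, hc]
    push_cast; simp; ring

/-- The return probability of the lazy walk decays like the inverse of the standard deviation. -/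
theorem lazyWalk_zero_sq_le {q : ℝ} (h0 : 0 ≤ q) (h1 : 4 * q ≤ 1) (m : ℕ) :
    2 * q * m * lazyWalk q m 0 ^ 2 ≤ 1 := by
  set a := 2 * q * m with ha
  have ha0 : 0 ≤ a := by positivity
  rcases ha0.eq_or_lt with h | hpos
  · rw [← h]; norm_num
  have hs : 0 < √a := Real.sqrt_pos.2 hpos
  have hsq : √a * √a = a := Real.mul_self_sqrt ha0
  have hav := (isAveraging_lazyStep h0 (by linarith)).pow m
  -- Upper bound for the expected modulus by the standard deviation. Cauchy–Schwarz is replaced by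
  -- the pointwise bound |x| ≤ x²/(2√a) + √a/2.
  have hle : (lazyStep q ^ m) (fun x => |(x : ℝ)|) 0 ≤ √a := by
    have := hav.mono (fun x => |(x : ℝ)|)
      ((1 / (2 * √a)) • (fun x : ℤ => ((x : ℝ) - (0 : ℤ)) ^ 2) + fun _ => √a / 2) (fun x => by
        simp only [Pi.add_apply, Pi.smul_apply, smul_eq_mul, Int.cast_zero, sub_zero]
        rw [← sq_abs, div_mul_eq_mul_div, one_mul, div_add_div _ _ (by positivity) (by norm_num),
          le_div_iff₀ (by positivity)]
        nlinarith [sq_nonneg (|(x : ℝ)| - √a)]) 0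
    rw [map_add, map_smul, Pi.add_apply, Pi.smul_apply, lazyStep_pow_sq, hav.const, ← ha] at this
    refine this.trans (le_of_eq ?_)
    rw [smul_eq_mul, show 1 / (2 * √a) * a = a / √a / 2 by field_simp, Real.div_sqrt]; ring
  rw [lazyStep_pow_abs] at hle
  -- Lower bound for the same quantity: the return probabilities decrease in time, so each of the m
  -- summands is at least the last one.
  have hsum : m * lazyWalk q m 0 ≤ ∑ j ∈ Finset.range m, lazyWalk q j 0 := by
    have := Finset.card_nsmul_le_sum (Finset.range m) (fun j => lazyWalk q j 0) (lazyWalk q m 0)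
      (fun j hj => lazyWalk_zero_antitone h0 h1 (Finset.mem_range.1 hj).le)
    simpa using this
  have h2 : a * lazyWalk q m 0 ≤ √a := by
    calc a * lazyWalk q m 0 = 2 * q * (m * lazyWalk q m 0) := by rw [ha]; ring
      _ ≤ _ := mul_le_mul_of_nonneg_left hsum (by positivity)
      _ ≤ _ := hle
  have h3 : √a * lazyWalk q m 0 ≤ 1 := by
    refine le_of_mul_le_mul_left ?_ hs
    rw [← mul_assoc, hsq, mul_one]; exact h2
  nlinarith [mul_nonneg hs.le (lazyWalk_nonneg h0 h1 m 0)]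

/-- Pair off m steps of each kind into a lazy walk. Averaging over the remaining steps cannot exceed
the maximum of the walk's point probabilities, which is attained at 0. -/
theorem up_pow_down_pow_point_le {p : ℝ} (h0 : 0 ≤ p) (h1 : p ≤ 1) {a b m : ℕ} (ha : m ≤ a)
    (hb : m ≤ b) (k x : ℤ) :
    (up p ^ a * down p ^ b) (point k) x ≤ lazyWalk (p * (1 - p)) m 0 := by
  obtain ⟨c, rfl⟩ := Nat.exists_eq_add_of_le ha
  obtain ⟨d, rfl⟩ := Nat.exists_eq_add_of_le hb
  have e : up p ^ (m + c) * down p ^ (m + d)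
      = (up p ^ c * down p ^ d) * lazyStep (p * (1 - p)) ^ m := by
    rw [← up_mul_down, (commute_up_down p p).mul_pow, add_comm m c, pow_add, add_comm m d,
      pow_add, mul_assoc, mul_assoc]
    congr 1
    rw [← mul_assoc, ← mul_assoc, ((commute_up_down p p).pow_pow m d).eq]
  rw [e, Module.End.mul_apply]
  have hq0 : 0 ≤ p * (1 - p) := mul_nonneg h0 (by linarith)
  have hq1 : 4 * (p * (1 - p)) ≤ 1 := by nlinarith [sq_nonneg (2 * p - 1)]
  refine (((isAveraging_up h0 h1).pow c).mul ((isAveraging_down h0 h1).pow d)).le_of_le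
    (fun y => ?_) x
  rw [lazyStep_pow_point]
  exact lazyWalk_le_zero hq0 hq1 m _

/-! ### The bias of a sum with more positive than negative steps -/

/-- The sign of `x - 3 / 2`. -/
def threshold (x : ℤ) : ℝ := if 2 ≤ x then 1 else -1

theorem up_pow_sq (p : ℝ) (d : ℕ) :
    (up p ^ d) (fun x => ((x : ℝ) - d * p) ^ 2) 0 = d * (p * (1 - p)) := by
  have key (k : ℕ) (r : ℝ) : (up p ^ k) (fun x => ((x : ℝ) - r) ^ 2)
      = fun x : ℤ => ((x : ℝ) + k * p - r) ^ 2 + k * (p * (1 - p)) := by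
    induction k with
    | zero => ext x; simp
    | succ k ih =>
      rw [pow_succ', Module.End.mul_apply, ih]
      ext x
      simp only [up_apply]
      push_cast; ring
  rw [key]; simp

section Bias

variable {q : ℝ}

theorem lazyStep_pow_threshold_succ (m : ℕ) (z : ℤ) :
    (lazyStep q ^ m) threshold (z + 1)
      = (lazyStep q ^ m) threshold z + 2 * lazyWalk q m (z - 1) := by
  have h : shift 1 threshold = threshold + (2 : ℝ) • point 1 := by
    ext x
    simp only [shift_apply, Pi.add_apply, Pi.smul_apply, threshold, point, smul_eq_mul]
    split_ifs <;> first | omega | norm_num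
  have := congrArg (fun T : Module.End ℝ (ℤ → ℝ) => T threshold z)
    ((commute_lazyStep_shift q 1).pow_left m).eq
  simp only [Module.End.mul_apply, h, map_add, map_smul, Pi.add_apply, Pi.smul_apply,
    lazyStep_pow_point, shift_apply, smul_eq_mul] at this
  linarith

theorem lazyStep_pow_threshold_symm (m : ℕ) (z : ℤ) :
    (lazyStep q ^ m) threshold (3 - z) = -(lazyStep q ^ m) threshold z := by
  induction m generalizing z with
  | zero =>
    simp only [pow_zero, Module.End.one_apply, threshold]
    split_ifs <;> first | omega | norm_num
  | succ m ih =>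
    simp only [pow_succ', Module.End.mul_apply, lazyStep_apply]
    rw [ih, show 3 - z + 1 = 3 - (z - 1) by ring, ih, show 3 - z - 1 = 3 - (z + 1) by ring, ih]
    ring

theorem lazyStep_pow_threshold_two (m : ℕ) :
    (lazyStep q ^ m) threshold 2 = lazyWalk q m 0 := by
  have a := lazyStep_pow_threshold_succ (q := q) m 1
  have b := lazyStep_pow_threshold_symm (q := q) m 2
  norm_num at a b
  linarith

theorem lazyStep_pow_threshold_mono (h0 : 0 ≤ q) (h1 : 4 * q ≤ 1) (m : ℕ) :
    Monotone ((lazyStep q ^ m) threshold) := by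
  refine monotone_int_of_le_succ fun z => ?_
  rw [lazyStep_pow_threshold_succ]
  linarith [lazyWalk_nonneg h0 h1 m (z - 1)]

/-- Descending from 2 to 0 costs two increments, each at most twice the return probability, from a
starting value of one return probability. This caps the loss when the surplus steps fail to push the
walk up. -/
theorem lazyStep_pow_threshold_zero_ge (h0 : 0 ≤ q) (h1 : 4 * q ≤ 1) (m : ℕ) :
    -(3 * lazyWalk q m 0) ≤ (lazyStep q ^ m) threshold 0 := by
  have a := lazyStep_pow_threshold_succ (q := q) m 1
  have b := lazyStep_pow_threshold_succ (q := q) m 0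
  have c := lazyStep_pow_threshold_two (q := q) m
  have := lazyWalk_le_zero h0 h1 m (-1)
  norm_num at a b
  linarith

theorem lazyStep_pow_threshold_ge (h0 : 0 ≤ q) (h1 : 4 * q ≤ 1) (m k : ℕ) :
    (2 * k + 1) * lazyWalk q m k ≤ (lazyStep q ^ m) threshold (k + 2) := by
  induction k with
  | zero => simp [lazyStep_pow_threshold_two]
  | succ k ih =>
    have := lazyStep_pow_threshold_succ (q := q) m (k + 2)
    have e : ((k : ℤ) + 2 - 1) = k + 1 := by ring
    rw [e] at this
    push_cast
    rw [show (k : ℤ) + 1 + 2 = k + 2 + 1 by ring, this]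
    nlinarith [lazyWalk_antitone h0 h1 m k]

/-- By unimodality the increments decrease to the right of 3/2, so the function is concave there and
its ratio to the distance from 3/2 decreases. -/
theorem lazyStep_pow_threshold_ratio (h0 : 0 ≤ q) (h1 : 4 * q ≤ 1) (m : ℕ) {k l : ℕ}
    (hkl : k ≤ l) :
    (2 * k + 1) * (lazyStep q ^ m) threshold (l + 2)
      ≤ (2 * l + 1) * (lazyStep q ^ m) threshold (k + 2) := by
  induction l, hkl using Nat.le_induction with
  | base => exact le_rfl
  | succ l hkl ih =>
    have a := lazyStep_pow_threshold_succ (q := q) m (l + 2)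
    have b := lazyStep_pow_threshold_ge h0 h1 m k
    have c := lazyWalk_antitone_nat h0 h1 m (show k ≤ l + 1 by omega)
    have e : ((l : ℤ) + 2 - 1) = l + 1 := by ring
    rw [e] at a
    push_cast at c ⊢
    rw [show (l : ℤ) + 1 + 2 = l + 2 + 1 by ring, a]
    have : (2 * (k : ℝ) + 1) * lazyWalk q m (l + 1) ≤ (2 * k + 1) * lazyWalk q m k :=
      mul_le_mul_of_nonneg_left c (by positivity)
    nlinarith

/-- Chebyshev: from l + 2 the walk must travel at least l + 1 to fall below the threshold, while its
variance is 2qm. The quadratic minorant of `threshold` in the proof encodes this. -/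
theorem lazyStep_pow_threshold_ge_half (h0 : 0 ≤ q) (h1 : 4 * q ≤ 1) {m l : ℕ}
    (hl : 8 * q * m ≤ ((l : ℝ) + 1) ^ 2) : 1 / 2 ≤ (lazyStep q ^ m) threshold (l + 2) := by
  have hav := (isAveraging_lazyStep h0 (by linarith : 2 * q ≤ 1)).pow m
  have hl0 : 0 < ((l : ℝ) + 1) ^ 2 := by positivity
  have := hav.mono ((fun _ => 1) - (2 / ((l : ℝ) + 1) ^ 2) •
      fun x : ℤ => ((x : ℝ) - ((l + 2 : ℤ) : ℝ)) ^ 2) threshold (fun x => by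
    simp only [Pi.sub_apply, Pi.smul_apply, smul_eq_mul, threshold]
    split_ifs with hx
    · have : 0 ≤ 2 / ((l : ℝ) + 1) ^ 2 * ((x : ℝ) - ((l + 2 : ℤ) : ℝ)) ^ 2 := by positivity
      linarith
    · have hx' : (x : ℝ) ≤ 1 := by exact_mod_cast (by omega : x ≤ 1)
      have : ((l : ℝ) + 1) ^ 2 ≤ ((x : ℝ) - ((l + 2 : ℤ) : ℝ)) ^ 2 := by
        push_cast
        rw [show (x : ℝ) - (l + 2) = -(l + 2 - x) by ring, neg_sq]
        gcongr; linarith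
      have : 2 ≤ 2 / ((l : ℝ) + 1) ^ 2 * ((x : ℝ) - ((l + 2 : ℤ) : ℝ)) ^ 2 := by
        rw [div_mul_eq_mul_div, le_div_iff₀ hl0]; linarith
      linarith) (l + 2)
  rw [map_sub, map_smul, Pi.sub_apply, Pi.smul_apply, lazyStep_pow_sq, hav.const,
    smul_eq_mul] at this
  refine le_trans ?_ this
  have : 2 / ((l : ℝ) + 1) ^ 2 * (2 * q * m) ≤ 1 / 2 := by
    rw [div_mul_eq_mul_div, div_le_iff₀ hl0]; linarith
  linarith

end Bias

theorem up_pow_down_pow_threshold_ge {p : ℝ} (h0 : 0 ≤ p) (h1 : p ≤ 1) {m d k : ℕ}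
    (hd : 32 ≤ d * p) (hk : (k : ℝ) + 2 ≤ d * p / 2) :
    (lazyStep (p * (1 - p)) ^ m) threshold (k + 2) / 2
      ≤ (up p ^ (m + d) * down p ^ m) threshold 0 := by
  have hq0 : 0 ≤ p * (1 - p) := mul_nonneg h0 (by linarith)
  have hq1 : 4 * (p * (1 - p)) ≤ 1 := by nlinarith [sq_nonneg (2 * p - 1)]
  rw [up_pow_mul_down_pow, Module.End.mul_apply]
  set g := (lazyStep (p * (1 - p)) ^ m) threshold with hg
  set μ : ℝ := d * p with hμ
  have gmono : Monotone g := lazyStep_pow_threshold_mono hq0 hq1 m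
  have hG0 : lazyWalk (p * (1 - p)) m 0 ≤ g (k + 2) := by
    rw [← lazyStep_pow_threshold_two]; exact gmono (by omega)
  have hf := lazyWalk_nonneg hq0 hq1 m 0
  have hg0 := lazyStep_pow_threshold_zero_ge hq0 hq1 m
  rw [← hg] at hg0
  have hav := (isAveraging_up h0 h1).pow d
  have hμ0 : 0 < μ := by linarith
  -- the walk only takes nonnegative values, so `g` may be truncated at `0`
  have trunc : (up p ^ d) (fun x => g (max x 0)) 0 = (up p ^ d) g 0 := by
    have key (j : ℕ) (x : ℤ) (hx : 0 ≤ x) :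
        (up p ^ j) (fun x => g (max x 0)) x = (up p ^ j) g x := by
      induction j generalizing x with
      | zero => simp [max_eq_left hx]
      | succ j ih =>
        rw [pow_succ', Module.End.mul_apply, Module.End.mul_apply, up_apply, up_apply, ih _ hx,
          ih _ (by omega)]
    exact key d 0 le_rfl
  rw [← trunc]
  -- Chebyshev for the d surplus steps, of mean μ and variance at most μ. Below k + 2 ≤ μ/2 the
  -- minorant is at most -3 g(k+2), hence at most g(0). Its quadratic term costs at most 16/μ ≤ 1/2
  -- of g(k+2).
  have := hav.mono ((fun _ => g (k + 2)) - (16 * g (k + 2) / μ ^ 2) •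
      fun x : ℤ => ((x : ℝ) - d * p) ^ 2) (fun x => g (max x 0)) (fun x => by
    simp only [Pi.sub_apply, Pi.smul_apply, smul_eq_mul]
    by_cases hx : (k : ℤ) + 2 ≤ x
    · have a : g (k + 2) ≤ g (max x 0) := gmono (le_max_of_le_left hx)
      have : 0 ≤ 16 * g (k + 2) / μ ^ 2 * ((x : ℝ) - d * p) ^ 2 := by
        have : 0 ≤ g (k + 2) := by linarith
        positivity
      linarith
    · have a : g 0 ≤ g (max x 0) := gmono (le_max_right _ _)
      have hx' : (x : ℝ) ≤ k + 2 := by exact_mod_cast (not_le.1 hx).le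
      have b : μ ^ 2 / 4 ≤ ((x : ℝ) - d * p) ^ 2 := by
        rw [← hμ]; nlinarith
      have : 4 * g (k + 2) ≤ 16 * g (k + 2) / μ ^ 2 * ((x : ℝ) - d * p) ^ 2 := by
        rw [div_mul_eq_mul_div, le_div_iff₀ (by positivity)]
        nlinarith
      linarith) 0
  rw [map_sub, map_smul, Pi.sub_apply, Pi.smul_apply, up_pow_sq, hav.const, smul_eq_mul] at this
  refine le_trans ?_ this
  have h3 : 16 * g (k + 2) / μ ^ 2 * (d * (p * (1 - p))) ≤ g (k + 2) / 2 := by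
    have : d * (p * (1 - p)) ≤ μ := by rw [hμ, ← mul_assoc]; nlinarith
    rw [div_mul_eq_mul_div, div_le_iff₀ (by positivity)]
    have hg2 : 0 ≤ g (k + 2) := by linarith
    calc 16 * g (k + 2) * (d * (p * (1 - p))) ≤ 16 * g (k + 2) * μ := by gcongr
      _ ≤ g (k + 2) / 2 * μ ^ 2 := by nlinarith [mul_nonneg hg2 hμ0.le]
  linarith

/-- The first-step bias: an excess `d` of positive over negative steps yields a bias of
order `d * √p / √n`. -/
theorem bias_ge {p c n : ℝ} (h0 : 0 < p) (h1 : p ≤ 1) (hc1 : c ≤ 1) {m d : ℕ}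
    (hm : m ≤ n) (hpn : 1 ≤ p * n) (hd : c * √n ≤ d) (hdp : 32 ≤ d * p) :
    c * √p / 96 ≤ (up p ^ (m + d) * down p ^ m) threshold 0 := by
  have hq0 : 0 ≤ p * (1 - p) := mul_nonneg h0.le (by linarith)
  have hq1 : 4 * (p * (1 - p)) ≤ 1 := by nlinarith [sq_nonneg (2 * p - 1)]
  have hn0 : 0 ≤ n := le_trans (Nat.cast_nonneg m) hm
  -- K is about half the mean push dp. L below is about three standard deviations of the walk,
  -- enough for bias 1/2 at L + 2. If K ≤ L, concavity interpolates between the two; otherwise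
  -- monotonicity suffices.
  obtain ⟨K, hK1, hK2⟩ : ∃ K : ℕ, (K : ℝ) + 2 ≤ d * p / 2 ∧ d * p / 2 ≤ 2 * K + 1 := by
    refine ⟨⌊d * p / 2 - 2⌋₊, ?_, ?_⟩
    · have := Nat.floor_le (by linarith : 0 ≤ d * p / 2 - 2)
      linarith
    · have := Nat.lt_floor_add_one (d * p / 2 - 2)
      linarith
  set s := √(p * n) with hs
  have hs1 : 1 ≤ s := Real.one_le_sqrt.2 hpn
  have hss : s ^ 2 = p * n := Real.sq_sqrt (by linarith)
  obtain ⟨L, hL1, hL2⟩ : ∃ L : ℕ, 3 * s ≤ L + 1 ∧ (L : ℝ) ≤ 3 * s := by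
    refine ⟨⌊3 * s⌋₊, (Nat.lt_floor_add_one _).le, Nat.floor_le (by positivity)⟩
  have hL : 8 * (p * (1 - p)) * m ≤ ((L : ℝ) + 1) ^ 2 := by
    have a : 8 * (p * (1 - p)) * m ≤ 8 * (p * n) := by
      have : p * (1 - p) * m ≤ p * n := by
        apply mul_le_mul _ hm (Nat.cast_nonneg m) h0.le
        nlinarith
      linarith
    nlinarith
  have half := lazyStep_pow_threshold_ge_half hq0 hq1 hL
  have hsp : √p ≤ 1 := Real.sqrt_le_one.2 h1
  have hsp0 : 0 ≤ √p := Real.sqrt_nonneg p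
  set g := (lazyStep (p * (1 - p)) ^ m) threshold with hg
  refine le_trans ?_ (up_pow_down_pow_threshold_ge h0.le h1 hdp hK1)
  rw [← hg]
  rcases le_total K L with hKL | hKL
  · have ratio := lazyStep_pow_threshold_ratio hq0 hq1 m hKL
    rw [← hg] at ratio
    have h2 : (2 * (K : ℝ) + 1) / 2 ≤ (2 * L + 1) * g (K + 2) := by nlinarith
    have h3 : (2 * (L : ℝ) + 1) ≤ 7 * s := by linarith
    have hgpos : 0 ≤ g (K + 2) := by
      by_contra hneg
      push Not at hneg
      have : (2 * (L : ℝ) + 1) * g (K + 2) < 0 := mul_neg_of_pos_of_neg (by positivity) hneg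
      have : 0 ≤ (K : ℝ) := Nat.cast_nonneg K
      linarith
    have h4 : d * p / 4 ≤ 7 * s * g (K + 2) := by
      have := mul_le_mul_of_nonneg_right h3 hgpos
      linarith
    have h5 : c * √p * s ≤ d * p := by
      have : √p * s = p * √n := by
        rw [hs, Real.sqrt_mul h0.le, ← mul_assoc, Real.mul_self_sqrt h0.le]
      rw [mul_assoc, this]
      nlinarith
    have h6 : (c * √p) * s ≤ (28 * g (K + 2)) * s := by nlinarith
    have h7 := le_of_mul_le_mul_right h6 (by linarith)
    linarith
  · have := lazyStep_pow_threshold_mono hq0 hq1 m (show (L : ℤ) + 2 ≤ K + 2 by omega)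
    rw [← hg] at this
    have : c * √p ≤ 1 := mul_le_one₀ hc1 hsp0 hsp
    linarith

end MajorityDynamics

namespace MajorityDynamics

open Finset

/-! ### Expectations over binomial random subsets -/

section Expect

variable {α β : Type*} [DecidableEq α] [DecidableEq β] {p : ℝ}

/-- The expectation of `F A` for a random subset `A` of `U` containing every element of `U`
independently with probability `p`. -/
noncomputable def expect (p : ℝ) (U : Finset α) (F : Finset α → ℝ) : ℝ :=
  ∑ A ∈ U.powerset, p ^ #A * (1 - p) ^ #(U \ A) * F A

theorem expect_empty (F : Finset α → ℝ) : expect p ∅ F = F ∅ := by simp [expect]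

theorem expect_insert {a : α} {U : Finset α} (ha : a ∉ U) (F : Finset α → ℝ) :
    expect p (insert a U) F = p * expect p U (fun A => F (insert a A)) + (1 - p) * expect p U F := by
  simp only [expect]
  rw [sum_powerset_insert ha, add_comm, mul_sum, mul_sum]
  congr 1
  · refine sum_congr rfl fun A hA => ?_
    have haA : a ∉ A := fun h => ha (mem_powerset.1 hA h)
    rw [card_insert_of_notMem haA, insert_sdiff_insert, sdiff_insert_of_notMem ha, pow_succ]
    ring
  · refine sum_congr rfl fun A hA => ?_
    have haA : a ∉ A := fun h => ha (mem_powerset.1 hA h)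
    rw [insert_sdiff_of_notMem _ haA, card_insert_of_notMem (by simp [ha]), pow_succ]
    ring

theorem expect_congr {U : Finset α} {F G : Finset α → ℝ} (h : ∀ A ⊆ U, F A = G A) :
    expect p U F = expect p U G :=
  sum_congr rfl fun A hA => by rw [h A (mem_powerset.1 hA)]

theorem expect_add (U : Finset α) (F G : Finset α → ℝ) :
    expect p U (fun A => F A + G A) = expect p U F + expect p U G := by
  simp only [expect, mul_add, sum_add_distrib]

theorem expect_sub (U : Finset α) (F G : Finset α → ℝ) :
    expect p U (fun A => F A - G A) = expect p U F - expect p U G := by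
  simp only [expect, mul_sub, sum_sub_distrib]

theorem expect_const_mul (U : Finset α) (r : ℝ) (F : Finset α → ℝ) :
    expect p U (fun A => r * F A) = r * expect p U F := by
  simp only [expect, mul_sum]
  exact sum_congr rfl fun A _ => by ring

theorem expect_mul_const (U : Finset α) (r : ℝ) (F : Finset α → ℝ) :
    expect p U (fun A => F A * r) = expect p U F * r := by
  simp only [mul_comm _ r, expect_const_mul]

theorem expect_sum {ι : Type*} (U : Finset α) (s : Finset ι) (F : ι → Finset α → ℝ) :
    expect p U (fun A => ∑ i ∈ s, F i A) = ∑ i ∈ s, expect p U (F i) := by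
  simp only [expect, mul_sum]
  exact sum_comm

theorem expect_prod (U : Finset α) (w : α → ℝ) :
    expect p U (fun A => ∏ e ∈ A, w e) = ∏ e ∈ U, (p * w e + (1 - p)) := by
  rw [prod_add]
  exact sum_congr rfl fun A _ => by rw [prod_mul_distrib, prod_const, prod_const]; ring

theorem expect_const (U : Finset α) (r : ℝ) : expect p U (fun _ => r) = r := by
  have := expect_prod (p := p) U fun _ => 1
  simp only [prod_const_one, mul_one, add_sub_cancel] at this
  have h := expect_const_mul (p := p) U r fun _ => 1
  simpa [this] using h

theorem expect_mono (h0 : 0 ≤ p) (h1 : p ≤ 1) {U : Finset α} {F G : Finset α → ℝ}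
    (h : ∀ A ⊆ U, F A ≤ G A) : expect p U F ≤ expect p U G := by
  have : 0 ≤ 1 - p := by linarith
  refine sum_le_sum fun A hA => mul_le_mul_of_nonneg_left (h A (mem_powerset.1 hA)) (by positivity)

theorem expect_union {U W : Finset α} (h : Disjoint U W) (F : Finset α → ℝ) :
    expect p (U ∪ W) F = expect p U fun A => expect p W fun B => F (A ∪ B) := by
  induction U using Finset.induction generalizing F with
  | empty => simp [expect_empty]
  | insert a U ha ih =>
    rw [disjoint_insert_left] at h
    rw [insert_union, expect_insert (by simp [ha, h.1]), expect_insert ha, ih h.2, ih h.2]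
    simp only [insert_union]

/-- The random variable `F` is determined by the random set within `W`. -/
def DeterminedBy (F : Finset α → ℝ) (W : Finset α) : Prop := ∀ A B, A ∩ W = B ∩ W → F A = F B

theorem DeterminedBy.expect_eq {F : Finset α → ℝ} {W U : Finset α} (hF : DeterminedBy F W)
    (h : W ⊆ U) : expect p U F = expect p W F := by
  rw [← union_sdiff_of_subset h, expect_union disjoint_sdiff]
  refine expect_congr fun A _ => ?_
  rw [expect_congr (G := fun _ => F A), expect_const]
  intro B hB
  refine hF _ _ ?_
  rw [union_inter_distrib_right, disjoint_iff_inter_eq_empty.1 (disjoint_sdiff.symm.mono_left hB), union_empty]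

theorem expect_mul {F G : Finset α → ℝ} {U W : Finset α} (hF : DeterminedBy F U)
    (hG : DeterminedBy G W) (h : Disjoint U W) :
    expect p (U ∪ W) (fun A => F A * G A) = expect p U F * expect p W G := by
  rw [expect_union h, ← expect_mul_const]
  refine expect_congr fun A hA => ?_
  rw [← expect_const_mul]
  refine expect_congr fun B hB => ?_
  congr 1
  · exact hF _ _ (by rw [union_inter_distrib_right, disjoint_iff_inter_eq_empty.1 (h.symm.mono_left hB), union_empty])
  · exact hG _ _ (by rw [union_inter_distrib_right, disjoint_iff_inter_eq_empty.1 (h.mono_left hA), empty_union])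

/-- The covariance of two random variables that share a single source of randomness `e`. -/
theorem expect_mul_sub {F G : Finset α → ℝ} {I J U : Finset α} {e : α} (heI : e ∉ I) (heJ : e ∉ J)
    (hIJ : Disjoint I J) (hU : insert e (I ∪ J) ⊆ U) (hF : DeterminedBy F (insert e I))
    (hG : DeterminedBy G (insert e J)) :
    expect p U (fun A => F A * G A) - expect p U F * expect p U G
      = p * (1 - p) * (expect p I (fun A => F (insert e A)) - expect p I F)
        * (expect p J (fun A => G (insert e A)) - expect p J G) := by
  have det1 {H : Finset α → ℝ} {K : Finset α} (hH : DeterminedBy H (insert e K)) :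
      DeterminedBy (fun A => H (insert e A)) K := fun A B hAB => hH _ _ (by
    rw [← insert_inter_distrib, ← insert_inter_distrib, hAB])
  -- deleting `e` first, the random variable does not depend on whether `e` is present
  have det0 {H : Finset α → ℝ} {K : Finset α} (hH : DeterminedBy H (insert e K)) :
      DeterminedBy (fun A => H (A.erase e)) K := fun A B hAB => hH _ _ (by
    ext x
    have := congrArg (x ∈ ·) hAB
    simp only [mem_inter, mem_erase, mem_insert, eq_iff_iff] at this ⊢
    tauto)
  have er {H : Finset α → ℝ} {K : Finset α} (hK : e ∉ K) :
      expect p K (fun A => H (A.erase e)) = expect p K H :=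
    expect_congr fun A hA => by rw [erase_eq_of_notMem fun h => hK (hA h)]
  have hFG : DeterminedBy (fun A => F A * G A) (insert e (I ∪ J)) := fun A B hAB => by
    have key (K : Finset α) (hK : K ⊆ insert e (I ∪ J)) : A ∩ K = B ∩ K := by
      rw [← inter_eq_right.2 hK, ← inter_assoc, hAB, inter_assoc]
    exact congrArg₂ _ (hF _ _ (key _ (insert_subset_insert _ subset_union_left)))
      (hG _ _ (key _ (insert_subset_insert _ subset_union_right)))
  rw [hFG.expect_eq hU, hF.expect_eq ((insert_subset_insert _ subset_union_left).trans hU),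
    hG.expect_eq ((insert_subset_insert _ subset_union_right).trans hU),
    expect_insert (by simp [heI, heJ]), expect_insert heI, expect_insert heJ,
    ← er (H := fun A => F A * G A) (K := I ∪ J) (by simp [heI, heJ]),
    expect_mul (det1 hF) (det1 hG) hIJ, expect_mul (det0 hF) (det0 hG) hIJ, er heI, er heJ]
  ring

theorem expect_image {f : β → α} {W : Finset β} (hf : Set.InjOn f W) (F : Finset α → ℝ) :
    expect p (W.image f) F = expect p W fun A => F (A.image f) := by
  induction W using Finset.induction generalizing F with
  | empty => simp [expect_empty]
  | insert a W ha ih =>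
    have hW : Set.InjOn f W := hf.mono (by simp)
    rw [image_insert, expect_insert, expect_insert ha, ih hW, ih hW]
    · simp only [image_insert]
    · simp only [mem_image, not_exists, not_and]
      intro x hx hxa
      exact ha (hf (by simp [hx]) (by simp) hxa ▸ hx)

omit [DecidableEq β] in
theorem filter_mem_image {f : β → α} {W A : Finset β} (hf : Set.InjOn f W) (hA : A ⊆ W) :
    {w ∈ W | f w ∈ A.image f} = A := by
  ext w
  simp only [mem_filter, mem_image]
  constructor
  · rintro ⟨hw, x, hx, hxw⟩
    rwa [← hf (hA hx) hw hxw]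
  · exact fun hw => ⟨hA hw, w, hw, rfl⟩

theorem expect_sum_sub_sq (W : Finset α) (x : α → ℝ) (r : ℝ) :
    expect p W (fun A => (∑ w ∈ A, x w - r) ^ 2)
      = (p * ∑ w ∈ W, x w - r) ^ 2 + p * (1 - p) * ∑ w ∈ W, x w ^ 2 := by
  induction W using Finset.induction generalizing r with
  | empty => simp [expect_empty]
  | insert a W ha ih =>
    have h : expect p W (fun A => (∑ w ∈ insert a A, x w - r) ^ 2)
        = expect p W (fun A => (∑ w ∈ A, x w - (r - x a)) ^ 2) :=
      expect_congr fun A hA => by rw [sum_insert fun h => ha (hA h)]; ring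
    rw [expect_insert ha, h, ih, ih, sum_insert ha, sum_insert ha]
    ring

/-- The bridge from random sets to operators: each element with sign +1 contributes one `up`, each
with sign -1 one `down`. -/
theorem expect_signed_sum (W : Finset α) (σ : α → ℤˣ) (φ : ℤ → ℝ) (x : ℤ) :
    expect p W (fun A => φ (x + ∑ w ∈ A, (σ w : ℤ)))
      = (up p ^ #{w ∈ W | σ w = 1} * down p ^ #{w ∈ W | σ w = -1}) φ x := by
  induction W using Finset.induction generalizing x with
  | empty => simp [expect_empty]
  | insert a W ha ih =>
    have h : expect p W (fun A => φ (x + ∑ w ∈ insert a A, (σ w : ℤ)))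
        = expect p W (fun A => φ (x + (σ a : ℤ) + ∑ w ∈ A, (σ w : ℤ))) :=
      expect_congr fun A hA => by rw [sum_insert fun h => ha (hA h)]; ring_nf
    rw [expect_insert ha, h, ih, ih, filter_insert, filter_insert]
    rcases Int.units_eq_one_or (σ a) with hs | hs
    · rw [hs, if_pos rfl, if_neg (by decide), card_insert_of_notMem (by simp [ha]), pow_succ',
        mul_assoc, Module.End.mul_apply (up p), up_apply]
      simp
    · rw [hs, if_neg (by decide), if_pos rfl, card_insert_of_notMem (by simp [ha]), pow_succ',
        ← mul_assoc, ((commute_up_down p p).pow_left _).eq, mul_assoc,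
        Module.End.mul_apply (down p), down_apply]
      simp [sub_eq_add_neg]

/-- Markov's inequality. -/
theorem expect_indicator_le (h0 : 0 ≤ p) (h1 : p ≤ 1) {U : Finset α} {F : Finset α → ℝ}
    (P : Finset α → Prop) [DecidablePred P] {r : ℝ} (hF : ∀ A ⊆ U, 0 ≤ F A)
    (hP : ∀ A ⊆ U, P A → r ≤ F A) (hr : 0 < r) :
    expect p U (fun A => if P A then 1 else 0) ≤ expect p U F / r := by
  rw [le_div_iff₀ hr, ← expect_mul_const]
  refine expect_mono h0 h1 fun A hA => ?_
  split_ifs with h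
  · rw [one_mul]; exact hP A hA h
  · rw [zero_mul]; exact hF A hA

end Expect

theorem up_pow_mul_down_pow_commute_shift (p : ℝ) (a b : ℕ) (k : ℤ) :
    Commute (up p ^ a * down p ^ b) (shift k) := by
  have h : Commute (down p) (shift k) := by
    ext φ x
    simp only [Module.End.mul_apply, down_apply, shift_apply, add_right_comm, sub_eq_add_neg]
  exact ((commute_up_shift p k).pow_left a).mul_left (h.pow_left b)

/-- The influence of a single step on the threshold of a sum. -/
theorem abs_threshold_sub_le {p : ℝ} (h0 : 0 ≤ p) (h1 : p ≤ 1) {a b m : ℕ} (ha : m ≤ a)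
    (hb : m ≤ b) (s : ℤˣ) :
    |(up p ^ a * down p ^ b) threshold s - (up p ^ a * down p ^ b) threshold 0|
      ≤ 2 * lazyWalk (p * (1 - p)) m 0 := by
  set T := up p ^ a * down p ^ b with hT
  have hav : IsAveraging T := ((isAveraging_up h0 h1).pow a).mul ((isAveraging_down h0 h1).pow b)
  have h : shift 1 threshold = threshold + (2 : ℝ) • point 1 := by
    ext x
    simp only [shift_apply, Pi.add_apply, Pi.smul_apply, threshold, point, smul_eq_mul]
    split_ifs <;> first | omega | norm_num
  -- Moving the start by one changes the outcome only if the sum lands exactly at the threshold, so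
  -- the influence is twice a point probability.
  have key (x : ℤ) : T threshold (x + 1) = T threshold x + 2 * T (point 1) x := by
    have := congrArg (fun T : Module.End ℝ (ℤ → ℝ) => T threshold x)
      (up_pow_mul_down_pow_commute_shift p a b 1).eq
    rw [← hT] at this
    simp only [Module.End.mul_apply, h, map_add, map_smul, Pi.add_apply, Pi.smul_apply,
      shift_apply, smul_eq_mul] at this
    exact this.symm
  have nonneg (x : ℤ) : 0 ≤ T (point 1) x :=
    hav.ge_of_ge (fun y => by unfold point; split_ifs <;> norm_num) x
  have le (x : ℤ) : T (point 1) x ≤ lazyWalk (p * (1 - p)) m 0 :=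
    up_pow_down_pow_point_le h0 h1 ha hb 1 x
  rcases Int.units_eq_one_or s with rfl | rfl
  · have := key 0
    rw [zero_add] at this
    rw [Units.val_one, this, add_sub_cancel_left, abs_of_nonneg (by linarith [nonneg 0])]
    linarith [le 0]
  · have := key (-1)
    rw [neg_add_cancel] at this
    rw [Units.val_neg, Units.val_one, this, sub_add_cancel_left, abs_neg,
      abs_of_nonneg (by linarith [nonneg (-1)])]
    linarith [le (-1)]

end MajorityDynamics

namespace MajorityDynamics

open Finset

variable {V : Type*} [Fintype V]

/-! ### One round of the dynamics and its sign symmetry. -/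

section Dynamics

open scoped Classical in
/-- The sum of the states of the neighbours of `v`. -/
noncomputable def nbrSum (G : SimpleGraph V) (S : V → ℤˣ) (v : V) : ℤ :=
  ∑ u with G.Adj v u, (S u : ℤ)

theorem step_apply (G : SimpleGraph V) (S : V → ℤˣ) (v : V) :
    step G S v = if nbrSum G S v ≠ 0 then sgn (nbrSum G S v) else S v := by
  have h : ∀ [inst : Fintype (G.neighborSet v)],
      ∑ u ∈ G.neighborFinset v, (S u : ℤ) = nbrSum G S v := by
    intro inst
    refine sum_congr ?_ fun _ _ => rfl
    ext u; simp
  simp only [step, h]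

theorem step_of_pos {G : SimpleGraph V} {S : V → ℤˣ} {v : V} (h : 0 < nbrSum G S v) :
    step G S v = 1 := by
  rw [step_apply, if_pos h.ne', sgn, if_neg (by omega)]

theorem step_neg (G : SimpleGraph V) (S : V → ℤˣ) : step G (-S) = -step G S := by
  ext1 v
  have h : nbrSum G (-S) v = -nbrSum G S v := by simp [nbrSum]
  rw [Pi.neg_apply, step_apply, step_apply, h]
  simp only [sgn, ne_eq, neg_eq_zero, Pi.neg_apply]
  split_ifs <;> first | omega | simp

theorem state_neg (G : SimpleGraph V) (S : V → ℤˣ) (t : ℕ) : state G (-S) t = -state G S t := by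
  induction t with
  | zero => rfl
  | succ t ih =>
    simp only [state, Function.iterate_succ_apply'] at ih ⊢
    rw [ih, step_neg]

end Dynamics

variable [DecidableEq V] {p : ℝ}

/-! ### Graphs as random edge sets, and the stars at single vertices. -/

/-- All potential edges. -/
def allEdges (V : Type*) [Fintype V] [DecidableEq V] : Finset (Sym2 V) := {e | ¬e.IsDiag}

/-- The edges from `u` to the vertices in `Y`. -/
def star (u : V) (Y : Finset V) : Finset (Sym2 V) := Y.image fun w => s(u, w)

/-- The graph with edge set `A`. -/
def graph (A : Finset (Sym2 V)) : SimpleGraph V := SimpleGraph.fromEdgeSet (A : Set (Sym2 V))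

omit [Fintype V] [DecidableEq V] in
theorem graph_adj {A : Finset (Sym2 V)} {u v : V} : (graph A).Adj u v ↔ s(u, v) ∈ A ∧ u ≠ v := by
  simp [graph]

omit [Fintype V] in
theorem mem_star {u x y : V} {Y : Finset V} :
    s(x, y) ∈ star u Y ↔ (x = u ∧ y ∈ Y) ∨ (y = u ∧ x ∈ Y) := by
  simp only [star, mem_image, Sym2.eq_iff]
  constructor
  · rintro ⟨w, hw, ⟨rfl, rfl⟩ | ⟨rfl, rfl⟩⟩ <;> simp [hw]
  · rintro (⟨rfl, h⟩ | ⟨rfl, h⟩)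
    · exact ⟨y, h, Or.inl ⟨rfl, rfl⟩⟩
    · exact ⟨x, h, Or.inr ⟨rfl, rfl⟩⟩

theorem star_subset_allEdges {u : V} {Y : Finset V} (h : u ∉ Y) : star u Y ⊆ allEdges V := by
  intro e
  induction e with
  | _ x y =>
    rw [mem_star]
    simp only [allEdges, mem_filter, mem_univ, true_and, Sym2.mk_isDiag_iff]
    rintro (⟨rfl, hy⟩ | ⟨rfl, hx⟩) rfl <;> contradiction

omit [Fintype V] [DecidableEq V] in
theorem spoke_injective (u : V) : Function.Injective fun w => s(u, w) :=
  fun _ _ h => Sym2.congr_right.1 h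

omit [Fintype V] in
theorem expect_star (u : V) (Y : Finset V) (σ : V → ℤˣ) (φ : ℤ → ℝ) (x : ℤ) :
    expect p (star u Y) (fun A => φ (x + ∑ w ∈ Y with s(u, w) ∈ A, (σ w : ℤ)))
      = (up p ^ #{w ∈ Y | σ w = 1} * down p ^ #{w ∈ Y | σ w = -1}) φ x := by
  rw [star, expect_image (spoke_injective u).injOn, ← expect_signed_sum]
  exact expect_congr fun A hA => by rw [filter_mem_image (spoke_injective u).injOn hA]

/-! ### The second round -/

/-- A lower bound for the state of the neighbour `u` of `v` after one round that does not depend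
on the edges at `v`. -/
noncomputable def decoupled (σ : V → ℤˣ) (v u : V) (A : Finset (Sym2 V)) : ℝ :=
  threshold (∑ w ∈ univ \ {u, v} with s(u, w) ∈ A, (σ w : ℤ))

theorem threshold_sq (x : ℤ) : threshold x ^ 2 = 1 := by
  unfold threshold; split_ifs <;> norm_num

/-- The state of v contributes at least -1 to the neighbour sum at u, so a sum of at least 2 over
the other neighbours forces state +1. This is why `threshold` jumps at 2. -/
theorem decoupled_le {σ : V → ℤˣ} {u v : V} {A : Finset (Sym2 V)} (h : (graph A).Adj v u) :
    decoupled σ v u A ≤ (step (graph A) σ u : ℤ) := by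
  unfold decoupled threshold
  split_ifs with hx
  · rw [step_of_pos]
    · simp
    have hv : (-1 : ℤ) ≤ σ v := by rcases Int.units_eq_one_or (σ v) with h | h <;> simp [h]
    refine lt_of_lt_of_le (by linarith : 0 < (σ v : ℤ) + ∑ w ∈ univ \ {u, v} with s(u, w) ∈ A, (σ w : ℤ)) (le_of_eq ?_)
    rw [nbrSum, ← sum_insert (f := fun y => (σ y : ℤ)) (by simp)]
    refine sum_congr ?_ fun _ _ => rfl
    rw [graph_adj, Sym2.eq_swap] at h
    ext w
    simp only [mem_insert, mem_filter, mem_sdiff, mem_univ, true_and, mem_singleton, graph_adj]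
    by_cases hw : w = v
    · subst hw; simp [h.1, h.2.symm]
    · simp only [hw, or_false, false_or]
      exact ⟨fun H => ⟨H.2, fun e => H.1 e.symm⟩, fun H => ⟨fun e => H.2 e.symm, H.1⟩⟩
  · rcases Int.units_eq_one_or (step (graph A) σ u) with h | h <;> norm_num [h]

theorem sum_decoupled_le (σ : V → ℤˣ) (v : V) (A : Finset (Sym2 V)) :
    ∑ u ∈ univ.erase v with s(v, u) ∈ A, decoupled σ v u A
      ≤ nbrSum (graph A) (step (graph A) σ) v := by
  rw [nbrSum, Int.cast_sum]
  refine (sum_le_sum fun u hu => decoupled_le ?_).trans (le_of_eq (sum_congr ?_ fun _ _ => rfl))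
  · simp only [mem_filter, mem_erase] at hu
    exact graph_adj.2 ⟨hu.2, hu.1.1.symm⟩
  · ext u; simp [graph_adj, and_comm, eq_comm]

theorem determinedBy_decoupled (σ : V → ℤˣ) (v u : V) :
    DeterminedBy (decoupled σ v u) (star u (univ \ {u, v})) := by
  intro A B h
  unfold decoupled
  congr 2
  ext w
  simp only [mem_filter, and_congr_right_iff]
  intro hw
  have := congrArg (s(u, w) ∈ ·) h
  simpa only [mem_inter, mem_star, hw, true_and, true_or, and_true, eq_iff_iff] using this

theorem expect_decoupled {σ : V → ℤˣ} {v u : V} :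
    expect p (allEdges V) (decoupled σ v u)
      = (up p ^ #{w ∈ univ \ {u, v} | σ w = 1} * down p ^ #{w ∈ univ \ {u, v} | σ w = -1})
          threshold 0 := by
  rw [(determinedBy_decoupled σ v u).expect_eq (star_subset_allEdges (by simp)), ← expect_star u]
  simp only [zero_add]
  rfl

/-- The two expectations correspond to the edge uw being present or absent. All other relevant edges
at u are still random and smooth out the difference. -/
theorem influence_decoupled {σ : V → ℤˣ} {v u w : V} (hwv : w ≠ v) (hwu : w ≠ u) (h0 : 0 ≤ p)
    (h1 : p ≤ 1) {m : ℕ} (ha : m ≤ #{y ∈ univ \ {u, v, w} | σ y = 1})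
    (hb : m ≤ #{y ∈ univ \ {u, v, w} | σ y = -1}) :
    |expect p (star u (univ \ {u, v, w})) (fun A => decoupled σ v u (insert s(u, w) A))
      - expect p (star u (univ \ {u, v, w})) (decoupled σ v u)|
      ≤ 2 * lazyWalk (p * (1 - p)) m 0 := by
  have hA (A) (hA : A ⊆ star u (univ \ {u, v, w})) :
      s(u, w) ∉ A := fun h => by
    have := hA h
    rw [mem_star] at this
    simp [hwu] at this
  have e1 : expect p (star u (univ \ {u, v, w})) (fun A => decoupled σ v u (insert s(u, w) A))
      = (up p ^ #{y ∈ univ \ {u, v, w} | σ y = 1} * down p ^ #{y ∈ univ \ {u, v, w} | σ y = -1})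
          threshold (σ w) := by
    rw [← expect_star]
    refine expect_congr fun A hAs => ?_
    rw [decoupled, ← sum_insert (f := fun y => (σ y : ℤ)) (by simp)]
    congr 2
    ext y
    simp only [mem_filter, mem_sdiff, mem_univ, true_and, mem_insert, mem_singleton,
      Sym2.congr_right]
    by_cases hy : y = w
    · subst hy; simp [hwv, hwu]
    · simp [hy]
  have e2 : expect p (star u (univ \ {u, v, w})) (decoupled σ v u)
      = (up p ^ #{y ∈ univ \ {u, v, w} | σ y = 1} * down p ^ #{y ∈ univ \ {u, v, w} | σ y = -1})
          threshold 0 := by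
    rw [← expect_star]
    refine expect_congr fun A hAs => ?_
    rw [decoupled, zero_add]
    congr 2
    ext y
    simp only [mem_filter, mem_sdiff, mem_univ, true_and, mem_insert, mem_singleton]
    by_cases hy : y = w
    · subst hy; simp [hA A hAs]
    · simp [hy]
  rw [e1, e2]
  exact abs_threshold_sub_le h0 h1 ha hb (σ w)

/-- Once v is excluded, the stars at u and w share only the edge uw. With q = p(1-p) the covariance
is at most q(2f)², where f is a return probability with 2qmf² ≤ 1, so p cancels. -/
theorem expect_decoupled_mul_sub_le {σ : V → ℤˣ} {v u w : V} (huv : u ≠ v) (hwv : w ≠ v)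
    (hwu : w ≠ u) (h0 : 0 ≤ p) (h1 : p ≤ 1) {m : ℕ} (hm : 0 < m)
    (ha : m ≤ #{y ∈ univ \ {u, v, w} | σ y = 1})
    (hb : m ≤ #{y ∈ univ \ {u, v, w} | σ y = -1}) :
    expect p (allEdges V) (fun A => decoupled σ v u A * decoupled σ v w A)
      - expect p (allEdges V) (decoupled σ v u) * expect p (allEdges V) (decoupled σ v w)
      ≤ 2 / m := by
  have hset : ({w, v, u} : Finset V) = {u, v, w} := by ext; simp; tauto
  have ins {a b : V} (hab : b ≠ a) (hbv : b ≠ v) :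
      star a (univ \ {a, v}) = insert s(a, b) (star a (univ \ {a, v, b})) := by
    rw [star, star, ← image_insert (fun y => s(a, y))]
    congr 1
    ext y
    by_cases hy : y = b
    · subst hy; simp [hab, hbv]
    · simp [hy]
  have hF := determinedBy_decoupled σ v u
  have hG := determinedBy_decoupled σ v w
  rw [ins hwu hwv] at hF
  rw [ins hwu.symm huv, hset, Sym2.eq_swap] at hG
  have hI : star u (univ \ {u, v, w}) ⊆ allEdges V := star_subset_allEdges (by simp)
  have hJ : star w (univ \ {u, v, w}) ⊆ allEdges V := star_subset_allEdges (by simp)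
  have hdis : Disjoint (star u (univ \ {u, v, w})) (star w (univ \ {u, v, w})) := by
    rw [disjoint_left]
    intro e
    induction e with
    | _ x y =>
      simp only [mem_star, mem_sdiff, mem_univ, true_and, mem_insert, mem_singleton]
      rintro (⟨rfl, hy⟩ | ⟨rfl, hy⟩) (⟨rfl, hx⟩ | ⟨rfl, hx⟩) <;> simp_all
  rw [expect_mul_sub (e := s(u, w)) (by simp [mem_star, hwu]) (by simp [mem_star, hwu.symm])
    hdis (insert_subset (by simp [allEdges, hwu.symm]) (union_subset hI hJ)) hF hG]
  have i1 := influence_decoupled hwv hwu h0 h1 ha hb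
  have i2 := influence_decoupled (σ := σ) (v := v) (u := w) (w := u) huv hwu.symm h0 h1
    (m := m) (by rwa [hset]) (by rwa [hset])
  rw [hset, Sym2.eq_swap] at i2
  set f := lazyWalk (p * (1 - p)) m 0 with hf
  have hq0 : 0 ≤ p * (1 - p) := mul_nonneg h0 (by linarith)
  have hq1 : 4 * (p * (1 - p)) ≤ 1 := by nlinarith [sq_nonneg (2 * p - 1)]
  have h2 := lazyWalk_zero_sq_le hq0 hq1 m
  rw [mul_assoc]
  have hle := mul_le_mul i1 i2 (abs_nonneg _) ((abs_nonneg _).trans i1)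
  rw [← abs_mul] at hle
  refine (mul_le_mul_of_nonneg_left ((le_abs_self _).trans hle) hq0).trans ?_
  rw [le_div_iff₀ (by exact_mod_cast hm)]
  nlinarith

/-- The n diagonal terms are variances of ±1 variables, hence at most 1. The off-diagonal ones are
bounded by the covariance estimate. -/
theorem expect_sum_decoupled_variance {σ : V → ℤˣ} {v : V} (h0 : 0 ≤ p) (h1 : p ≤ 1) {m : ℕ}
    (hm : 0 < m) (ha : ∀ u w, m ≤ #{y ∈ univ \ {u, v, w} | σ y = 1})
    (hb : ∀ u w, m ≤ #{y ∈ univ \ {u, v, w} | σ y = -1}) :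
    expect p (allEdges V) (fun A => (∑ u ∈ univ.erase v, decoupled σ v u A
        - ∑ u ∈ univ.erase v, expect p (allEdges V) (decoupled σ v u)) ^ 2)
      ≤ Fintype.card V + Fintype.card V ^ 2 * (2 / m) := by
  set E : V → ℝ := fun u => expect p (allEdges V) (decoupled σ v u) with hE
  have expand : expect p (allEdges V) (fun A => (∑ u ∈ univ.erase v, decoupled σ v u A
        - ∑ u ∈ univ.erase v, E u) ^ 2)
      = ∑ u ∈ univ.erase v, ∑ w ∈ univ.erase v,
        (expect p (allEdges V) (fun A => decoupled σ v u A * decoupled σ v w A) - E u * E w) := by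
    have : ∀ A, (∑ u ∈ univ.erase v, decoupled σ v u A - ∑ u ∈ univ.erase v, E u) ^ 2
        = ∑ u ∈ univ.erase v, ∑ w ∈ univ.erase v,
          (decoupled σ v u A * decoupled σ v w A - decoupled σ v u A * E w
            - (E u * decoupled σ v w A - E u * E w)) := by
      intro A
      rw [← sum_sub_distrib, sq, sum_mul_sum]
      refine sum_congr rfl fun u _ => sum_congr rfl fun w _ => by ring
    simp only [this, expect_sum, expect_sub, expect_mul_const, expect_const_mul, expect_const]
    refine sum_congr rfl fun u _ => sum_congr rfl fun w _ => ?_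
    change _ - E u * E w - (E u * E w - E u * E w) = _
    ring
  rw [expand]
  have hm0 : 0 ≤ 2 / (m : ℝ) := by positivity
  have bound : ∀ u ∈ univ.erase v, ∀ w ∈ univ.erase v,
      expect p (allEdges V) (fun A => decoupled σ v u A * decoupled σ v w A) - E u * E w
        ≤ (if u = w then 1 else 0) + 2 / m := by
    intro u hu w hw
    split_ifs with huw
    · subst huw
      have : ∀ A, decoupled σ v u A * decoupled σ v u A = 1 := fun A => by
        rw [← sq]; exact threshold_sq _
      simp only [this, expect_const]
      nlinarith [mul_self_nonneg (E u)]
    · rw [zero_add]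
      exact expect_decoupled_mul_sub_le (ne_of_mem_erase hu) (ne_of_mem_erase hw) (Ne.symm huw)
        h0 h1 hm (ha u w) (hb u w)
  refine (sum_le_sum fun u hu => sum_le_sum fun w hw => bound u hu w hw).trans ?_
  have hcard : (#(univ.erase v) : ℝ) ≤ Fintype.card V := by
    exact_mod_cast card_le_univ _
  simp only [sum_add_distrib, sum_const, nsmul_eq_mul]
  have : ∑ u ∈ univ.erase v, ∑ w ∈ univ.erase v, (if u = w then (1 : ℝ) else 0)
      = #(univ.erase v) := by
    rw [sum_congr rfl fun u hu => by rw [sum_ite_eq, if_pos hu]]; simp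
  rw [this, sq, mul_assoc]
  gcongr

/-- The edges at v are independent of the decoupled states. Conditionally on those states, the
neighbour sum is a weighted sum of independent Bernoulli variables with weights ±1, which gives the
last term. -/
theorem expect_second_round_sq {σ : V → ℤˣ} (v : V) (r : ℝ) :
    expect p (allEdges V)
        (fun A => (∑ u ∈ univ.erase v with s(v, u) ∈ A, decoupled σ v u A - r) ^ 2)
      = expect p (allEdges V) (fun A => (p * ∑ u ∈ univ.erase v, decoupled σ v u A - r) ^ 2)
        + p * (1 - p) * #(univ.erase v) := by
  set W := star v (univ.erase v) with hW
  set U := allEdges V \ W with hU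
  have hWU : W ⊆ allEdges V := star_subset_allEdges (by simp)
  have hdec (A B : Finset (Sym2 V)) (hB : B ⊆ W) (u) (hu : u ∈ univ.erase v) :
      decoupled σ v u (A ∪ B) = decoupled σ v u A := by
    refine determinedBy_decoupled σ v u _ _ ?_
    suffices h : Disjoint W (star u (univ \ {u, v})) by
      rw [union_inter_distrib_right, disjoint_iff_inter_eq_empty.1 (h.mono_left hB), union_empty]
    rw [disjoint_left]
    intro e
    have huv := ne_of_mem_erase hu
    induction e with
    | _ x y =>
      simp only [hW, mem_star, mem_sdiff, mem_univ, mem_erase, true_and, mem_insert, mem_singleton]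
      rintro (⟨rfl, hy⟩ | ⟨rfl, hy⟩) (⟨rfl, hx⟩ | ⟨rfl, hx⟩) <;> simp_all
  have hU2 : U ∪ W = allEdges V := sdiff_union_of_subset hWU
  rw [← hU2, expect_union sdiff_disjoint, expect_union sdiff_disjoint,
    ← expect_const (p := p) U (p * (1 - p) * #(univ.erase v)), ← expect_add]
  refine expect_congr fun A hA => ?_
  have e1 : expect p W (fun B => (p * ∑ u ∈ univ.erase v, decoupled σ v u (A ∪ B) - r) ^ 2)
      = (p * ∑ u ∈ univ.erase v, decoupled σ v u A - r) ^ 2 := by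
    rw [← expect_const (p := p) W ((p * ∑ u ∈ univ.erase v, decoupled σ v u A - r) ^ 2)]
    refine expect_congr fun B hB => ?_
    rw [sum_congr rfl (hdec A B hB)]
  have e2 : expect p W (fun B => (∑ u ∈ univ.erase v with s(v, u) ∈ A ∪ B,
        decoupled σ v u (A ∪ B) - r) ^ 2)
      = expect p (univ.erase v) (fun Y => (∑ u ∈ Y, decoupled σ v u A - r) ^ 2) := by
    rw [hW, star, expect_image (spoke_injective v).injOn]
    refine expect_congr fun Y hY => ?_
    have hset : ({u ∈ univ.erase v | s(v, u) ∈ A ∪ Y.image fun w => s(v, w)} : Finset V) = Y := by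
      rw [← filter_mem_image (spoke_injective v).injOn hY]
      refine filter_congr fun u hu => ?_
      rw [filter_mem_image (spoke_injective v).injOn hY, mem_union, or_iff_right]
      intro h
      have := (mem_sdiff.1 (hA h)).2
      rw [hW, mem_star] at this
      exact this (Or.inl ⟨rfl, hu⟩)
    rw [hset]
    congr 2
    exact sum_congr rfl fun u hu => hdec A _ (image_subset_image hY) u (hY hu)
  rw [e1, e2, expect_sum_sub_sq]
  simp only [decoupled, threshold_sq, sum_const, nsmul_eq_mul, mul_one]

end MajorityDynamics

namespace MajorityDynamics

open Finset

variable {V : Type*} [Fintype V] [DecidableEq V] {p : ℝ}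

/-! ### Counting signs, and Chebyshev's inequality for the second round. -/

omit [Fintype V] [DecidableEq V] in
theorem card_pos_add_card_neg (σ : V → ℤˣ) (Y : Finset V) :
    #{y ∈ Y | σ y = 1} + #{y ∈ Y | σ y = -1} = #Y := by
  rw [← card_filter_add_card_filter_not (s := Y) (fun y => σ y = 1)]
  congr 2
  refine filter_congr fun y _ => ?_
  rcases Int.units_eq_one_or (σ y) with h | h <;> rw [h] <;> decide

omit [Fintype V] [DecidableEq V] in
theorem card_pos_sub_card_neg (σ : V → ℤˣ) (Y : Finset V) :
    (#{y ∈ Y | σ y = 1} : ℤ) - #{y ∈ Y | σ y = -1} = ∑ y ∈ Y, (σ y : ℤ) := by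
  simp only [card_filter, Nat.cast_sum, ← sum_sub_distrib]
  refine sum_congr rfl fun y _ => ?_
  rcases Int.units_eq_one_or (σ y) with h | h <;> rw [h] <;> decide

omit [Fintype V] [DecidableEq V] in
theorem abs_sum_units_le (σ : V → ℤˣ) (Y : Finset V) : |∑ y ∈ Y, (σ y : ℤ)| ≤ #Y := by
  refine (abs_sum_le_sum_abs _ _).trans ((sum_le_card_nsmul Y _ 1 fun y _ => ?_).trans (by simp))
  rcases Int.units_eq_one_or (σ y) with h | h <;> simp [h]

theorem card_signs_sdiff (σ : V → ℤˣ) (T : Finset V) {k : ℕ} (hT : #T ≤ k) :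
    (Fintype.card V : ℤ) - k
        ≤ #{y ∈ univ \ T | σ y = 1} + #{y ∈ univ \ T | σ y = -1} ∧
    |(#{y ∈ univ \ T | σ y = 1} : ℤ) - #{y ∈ univ \ T | σ y = -1} - ∑ v, (σ v : ℤ)| ≤ k := by
  constructor
  · have := card_pos_add_card_neg σ (univ \ T)
    have h2 := card_sdiff_add_card_eq_card (subset_univ T)
    rw [card_univ] at h2
    omega
  · rw [card_pos_sub_card_neg, ← sum_sdiff (subset_univ T), sub_add_cancel_left, abs_neg]
    exact (abs_sum_units_le σ T).trans (by exact_mod_cast hT)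

/-- After a clear initial majority, a given vertex is unlikely to be in the minority after the
second round. -/
theorem expect_second_round_le {σ : V → ℤˣ} (v : V) {c : ℝ} (h0 : 0 < p) (h1 : p ≤ 1) (hc : 0 < c)
    (hc1 : c ≤ 1) (hn : 100 ≤ Fintype.card V)
    (hD : c * √(Fintype.card V) + 2 ≤ (∑ v, (σ v : ℤ) : ℤ))
    (hD4 : 4 * (∑ v, (σ v : ℤ)) ≤ Fintype.card V)
    (hDp : 32 ≤ ((∑ v, (σ v : ℤ) : ℤ) - 2 : ℝ) * p) :
    expect p (allEdges V) (fun A => if nbrSum (graph A) (step (graph A) σ) v ≤ 0 then 1 else 0)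
      ≤ 663552 / (c ^ 2 * p ^ 2 * Fintype.card V) := by
  set n := Fintype.card V with hndef
  set D := ∑ v, (σ v : ℤ) with hDdef
  have hn' : (100 : ℝ) ≤ n := by exact_mod_cast hn
  have hD4' : 4 * (D : ℝ) ≤ n := by exact_mod_cast hD4
  have hpn : 1 ≤ p * n := by nlinarith
  -- Since 0 ≤ D ≤ n/4, both signs keep at least n/4 representatives after removing three vertices.
  -- Both are needed to pair off enough lazy steps.
  have hm (u w : V) : n / 4 ≤ #{y ∈ univ \ {u, v, w} | σ y = 1} ∧
      n / 4 ≤ #{y ∈ univ \ {u, v, w} | σ y = -1} := by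
    have := card_signs_sdiff σ {u, v, w} (card_le_three)
    rw [abs_le] at this
    have : 0 ≤ (D : ℝ) := by
      have : 0 ≤ c * √n := by positivity
      linarith
    have : 0 ≤ D := by exact_mod_cast this
    omega
  have hvar := expect_sum_decoupled_variance (σ := σ) (v := v) h0.le h1 (m := n / 4) (by omega)
    (fun u w => (hm u w).1) (fun u w => (hm u w).2)
  set M : ℝ := ∑ u ∈ univ.erase v, expect p (allEdges V) (decoupled σ v u) with hM
  set η := c * √p / 96 with hη
  have hη0 : 0 < η := by have := Real.sqrt_pos.2 h0; positivity
  have hbias (u : V) : η ≤ expect p (allEdges V) (decoupled σ v u) := by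
    have := card_signs_sdiff σ {u, v} (card_le_two)
    rw [abs_le] at this
    have hle : #{y ∈ univ \ {u, v} | σ y = -1} ≤ n := card_le_univ _
    rw [expect_decoupled]
    set a := #{y ∈ univ \ {u, v} | σ y = 1}
    set b := #{y ∈ univ \ {u, v} | σ y = -1}
    have hge : D - 2 ≤ a - b := by push_cast at this; omega
    have hge' : (D : ℝ) - 2 ≤ (a : ℝ) - b := by exact_mod_cast hge
    have hDpos : (0 : ℝ) ≤ D - 2 := by
      have : 0 ≤ c * √n := by positivity
      linarith
    have hab : b ≤ a := by
      have : (b : ℝ) ≤ a := by linarith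
      exact_mod_cast this
    obtain ⟨d, hd⟩ := Nat.exists_eq_add_of_le hab
    rw [hd] at hge' ⊢
    push_cast at hge'
    refine bias_ge h0 h1 hc1 (n := n) (by exact_mod_cast hle) hpn (by linarith) ?_
    refine hDp.trans ?_
    gcongr
    linarith
  have hMge : (n - 1) * η ≤ M := by
    have := card_nsmul_le_sum (univ.erase v) _ η fun u _ => hbias u
    rw [card_erase_of_mem (mem_univ v), card_univ, nsmul_eq_mul, Nat.cast_sub (by omega)] at this
    rwa [Nat.cast_one] at this
  have hMge' : n * η / 2 ≤ M := by nlinarith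
  have hM0 : 0 < M := lt_of_lt_of_le (by positivity) hMge'
  have hvarn : (n : ℝ) + n ^ 2 * (2 / (n / 4 : ℕ)) ≤ 17 * n := by
    have h8 : (n : ℝ) / 8 ≤ (n / 4 : ℕ) := by
      rw [div_le_iff₀ (by norm_num)]
      exact_mod_cast (by omega : n ≤ n / 4 * 8)
    have : 2 / ((n / 4 : ℕ) : ℝ) ≤ 16 / n := by
      rw [div_le_div_iff₀ (by linarith) (by linarith)]; linarith
    have h3 : (n : ℝ) ^ 2 * (2 / (n / 4 : ℕ)) ≤ n ^ 2 * (16 / n) := by gcongr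
    have h4 : (n : ℝ) ^ 2 * (16 / n) = 16 * n := by field_simp
    linarith
  have hsq := expect_second_round_sq (p := p) (σ := σ) v (p * M)
  have hbound : expect p (allEdges V)
      (fun A => (∑ u ∈ univ.erase v with s(v, u) ∈ A, decoupled σ v u A - p * M) ^ 2)
      ≤ 18 * (p * n) := by
    rw [hsq]
    have e : expect p (allEdges V)
        (fun A => (p * ∑ u ∈ univ.erase v, decoupled σ v u A - p * M) ^ 2)
        = p ^ 2 * expect p (allEdges V)
          (fun A => (∑ u ∈ univ.erase v, decoupled σ v u A - M) ^ 2) := by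
      rw [← expect_const_mul]
      congr 1
      ext A; ring
    have hcard : (#(univ.erase v) : ℝ) ≤ n := by exact_mod_cast card_le_univ _
    rw [e]
    have a1 : p ^ 2 * expect p (allEdges V)
        (fun A => (∑ u ∈ univ.erase v, decoupled σ v u A - M) ^ 2) ≤ p ^ 2 * (17 * n) := by
      gcongr; exact hvar.trans hvarn
    have a2 : p ^ 2 * (17 * n) ≤ 17 * (p * n) := by
      nlinarith [mul_nonneg (mul_nonneg h0.le (sub_nonneg.2 h1)) (by linarith : (0 : ℝ) ≤ n)]
    have a3 : p * (1 - p) * #(univ.erase v) ≤ p * n := by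
      refine mul_le_mul ?_ hcard (Nat.cast_nonneg _) h0.le
      nlinarith
    linarith
  -- A nonpositive neighbour sum forces its decoupled lower bound to fall short of its mean pM by at
  -- least pM. The final constant is 18 · 4 · 96².
  have hmarkov := expect_indicator_le h0.le h1 (U := allEdges V)
    (F := fun A => (∑ u ∈ univ.erase v with s(v, u) ∈ A, decoupled σ v u A - p * M) ^ 2)
    (fun A => nbrSum (graph A) (step (graph A) σ) v ≤ 0) (r := (p * M) ^ 2)
    (fun A _ => sq_nonneg _) (fun A _ hA => by
      have h := sum_decoupled_le σ v A
      have hA' : ((nbrSum (graph A) (step (graph A) σ) v : ℤ) : ℝ) ≤ 0 := by exact_mod_cast hA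
      have : 0 < p * M := by positivity
      nlinarith) (by positivity)
  refine hmarkov.trans ?_
  refine (div_le_div₀ (by positivity) hbound (c := 18 * (p * n)) (d := (p * (n * η / 2)) ^ 2)
    (by positivity) (by gcongr)).trans (le_of_eq ?_)
  have hs : √p ^ 2 = p := Real.sq_sqrt h0.le
  have hη2 : η ^ 2 = c ^ 2 * p / 9216 := by rw [hη, div_pow, mul_pow, hs]; norm_num
  have : (p * (n * η / 2)) ^ 2 = p ^ 2 * n ^ 2 * η ^ 2 / 4 := by ring
  rw [this, hη2]
  field_simp
  norm_num

/-! ### Pseudo-randomness of the random graph -/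

/-- The sum of `nbrSum G τ v` over `v ∈ B`, written as a sum over the edges. -/
theorem sum_nbrSum_eq (τ : V → ℤˣ) (B : Finset V) {A : Finset (Sym2 V)} (hA : A ⊆ allEdges V) :
    ∑ v ∈ B, nbrSum (graph A) τ v
      = ∑ e ∈ A, ∑ v ∈ B, ∑ u, if e = s(v, u) then (τ u : ℤ) else 0 := by
  classical
  rw [sum_comm]
  refine sum_congr rfl fun v _ => ?_
  rw [sum_comm, nbrSum, sum_filter]
  refine sum_congr rfl fun u _ => ?_
  rw [sum_ite_eq']
  refine if_congr ?_ rfl rfl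
  rw [graph_adj, and_iff_left_iff_imp]
  intro h
  simpa [allEdges] using hA h

/-- A Chernoff bound. The constraint t ≤ 1/2 keeps |t·c(e)| ≤ 1, so exp x ≤ 1 + x + x² applies, and
c(e)² ≤ 2k(e) makes the quadratic term linear in k. -/
theorem expect_sum_le_exp {α : Type*} [DecidableEq α] (h0 : 0 ≤ p) (h1 : p ≤ 1) (U : Finset α)
    {c k : α → ℝ} (hck : ∀ e, |c e| ≤ k e) (hk : ∀ e, k e ≤ 2) {t : ℝ} (ht0 : 0 ≤ t)
    (ht : t ≤ 1 / 2) (s : ℝ) :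
    expect p U (fun A => if ∑ e ∈ A, c e ≤ s then 1 else 0)
      ≤ Real.exp (t * s + p * (2 * t ^ 2 * ∑ e ∈ U, k e - t * ∑ e ∈ U, c e)) := by
  have hm := expect_indicator_le h0 h1 (U := U) (F := fun A => ∏ e ∈ A, Real.exp (-(t * c e)))
    (fun A => ∑ e ∈ A, c e ≤ s) (r := Real.exp (-(t * s)))
    (fun A _ => prod_nonneg fun _ _ => (Real.exp_pos _).le) (fun A _ hA => by
      rw [← Real.exp_sum, sum_neg_distrib, ← mul_sum]
      gcongr) (Real.exp_pos _)
  refine hm.trans ?_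
  rw [div_le_iff₀ (Real.exp_pos _), ← Real.exp_add, expect_prod]
  have hterm (e : α) : p * Real.exp (-(t * c e)) + (1 - p)
      ≤ Real.exp (p * (2 * t ^ 2 * k e - t * c e)) := by
    have hc2 : |c e| ≤ 2 := (hck e).trans (hk e)
    have hx : |-(t * c e)| ≤ 1 := by
      rw [abs_neg, abs_mul, abs_of_nonneg ht0]
      nlinarith [abs_nonneg (c e)]
    have hexp := (abs_le.1 (Real.abs_exp_sub_one_sub_id_le hx)).2
    have hsq : c e ^ 2 ≤ 2 * k e := by
      rw [← sq_abs]; nlinarith [abs_nonneg (c e), hck e]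
    have h2 : (-(t * c e)) ^ 2 ≤ 2 * t ^ 2 * k e := by
      nlinarith [mul_le_mul_of_nonneg_left hsq (sq_nonneg t)]
    refine le_trans ?_ (Real.add_one_le_exp _)
    have : p * (Real.exp (-(t * c e)) - 1) ≤ p * (2 * t ^ 2 * k e - t * c e) :=
      mul_le_mul_of_nonneg_left (by linarith) h0
    linarith
  refine (prod_le_prod (fun e _ => ?_) fun e _ => hterm e).trans (le_of_eq ?_)
  · have := mul_nonneg h0 (Real.exp_pos (-(t * c e))).le
    linarith
  · rw [← Real.exp_sum]
    congr 1
    rw [← mul_sum, sum_sub_distrib, ← mul_sum, ← mul_sum]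
    ring

theorem expect_sum_nbrSum_le_exp (h0 : 0 ≤ p) (h1 : p ≤ 1) (τ : V → ℤˣ) (B : Finset V) {t : ℝ}
    (ht0 : 0 ≤ t) (ht : t ≤ 1 / 2) (s : ℤ) :
    expect p (allEdges V) (fun A => if ∑ v ∈ B, nbrSum (graph A) τ v ≤ s then 1 else 0)
      ≤ Real.exp (t * s + p * (2 * t ^ 2 * (#B * Fintype.card V)
          - t * (#B * ((∑ u, (τ u : ℤ) : ℤ) - 1)))) := by
  set c : Sym2 V → ℤ := fun e => ∑ v ∈ B, ∑ u, if e = s(v, u) then (τ u : ℤ) else 0 with hc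
  set k : Sym2 V → ℤ := fun e => ∑ v ∈ B, ∑ u, if e = s(v, u) then 1 else 0 with hk
  have habs (e : Sym2 V) : |c e| ≤ k e := by
    refine (abs_sum_le_sum_abs _ _).trans (sum_le_sum fun v _ => ?_)
    refine (abs_sum_le_sum_abs _ _).trans (sum_le_sum fun u _ => ?_)
    split_ifs
    · rcases Int.units_eq_one_or (τ u) with h | h <;> simp [h]
    · simp
  -- An edge is counted once for each endpoint in B.
  have hk2 (e : Sym2 V) : k e ≤ 2 := by
    induction e with
    | _ x y =>
      have : k s(x, y) ≤ ∑ v, ∑ u, ((if v = x then if u = y then 1 else 0 else 0)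
          + (if v = y then if u = x then 1 else 0 else 0) : ℤ) := by
        refine (sum_le_univ_sum_of_nonneg fun v => sum_nonneg fun u _ => ?_).trans
          (sum_le_sum fun v _ => sum_le_sum fun u _ => ?_)
        · split_ifs <;> norm_num
        · simp only [Sym2.eq_iff]
          split_ifs <;> grind
      refine this.trans (le_of_eq ?_)
      simp [sum_add_distrib]
  have hswap (f : V → ℤ) : ∑ e ∈ allEdges V, ∑ v ∈ B, ∑ u, (if e = s(v, u) then f u else 0)
      = ∑ v ∈ B, (∑ u, f u - f v) := by
    rw [sum_comm]
    refine sum_congr rfl fun v _ => ?_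
    rw [sum_comm, ← sum_erase_eq_sub (mem_univ v), ← filter_ne', sum_filter]
    refine sum_congr rfl fun u _ => ?_
    rw [sum_ite_eq']
    simp [allEdges, eq_comm]
  have hksum : ∑ e ∈ allEdges V, k e ≤ #B * Fintype.card V := by
    rw [hswap fun _ => 1, ← nsmul_eq_mul]
    refine sum_le_card_nsmul _ _ _ fun v _ => ?_
    simp
  -- A vertex is not its own neighbour; dropping its own state costs at most 1.
  have hcsum : #B * (∑ u, (τ u : ℤ) - 1) ≤ ∑ e ∈ allEdges V, c e := by
    rw [hswap fun u => (τ u : ℤ), ← nsmul_eq_mul]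
    refine card_nsmul_le_sum _ _ _ fun v _ => ?_
    rcases Int.units_eq_one_or (τ v) with h | h <;> simp only [h, Units.val_neg, Units.val_one] <;>
      linarith
  have := expect_sum_le_exp h0 h1 (allEdges V) (c := fun e => (c e : ℝ)) (k := fun e => (k e : ℝ))
    (fun e => by exact_mod_cast habs e) (fun e => by exact_mod_cast hk2 e) ht0 ht s
  have hksum' : ∑ e ∈ allEdges V, (k e : ℝ) ≤ #B * Fintype.card V := by exact_mod_cast hksum
  have hcsum' : #B * (((∑ u, (τ u : ℤ) : ℤ) : ℝ) - 1) ≤ ∑ e ∈ allEdges V, (c e : ℝ) := by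
    exact_mod_cast hcsum
  refine le_trans (le_of_eq (expect_congr fun A hA => ?_)) (this.trans ?_)
  · rw [sum_nbrSum_eq τ B hA]
    refine if_congr ?_ rfl rfl
    rw [← Int.cast_sum, Int.cast_le]
  · gcongr

/-! ### The last two rounds -/

omit [DecidableEq V] in
/-- If almost all vertices agree after two rounds and the graph is pseudo-random, then all
vertices agree after four rounds. -/
theorem state_four_eq_one {G : SimpleGraph V} {S : V → ℤˣ} {b : ℕ}
    (h2 : 8 * #{v | nbrSum G (step G S) v ≤ 0} ≤ Fintype.card V)
    (h3 : ∀ τ : V → ℤˣ, 8 * #{v | τ v = -1} ≤ Fintype.card V → ∀ B : Finset V, #B = b →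
      0 < ∑ v ∈ B, nbrSum G τ v)
    (h4 : ∀ v, 2 * (b : ℤ) < nbrSum G 1 v) (v : V) : state G S 4 v = 1 := by
  have sub (τ : V → ℤˣ) : ({v | step G τ v = -1} : Finset V) ⊆ ({v | nbrSum G τ v ≤ 0} : Finset V) := by
    intro v
    simp only [mem_filter, mem_univ, true_and]
    contrapose!
    intro h
    rw [step_of_pos h]
    decide
  have h5 := h3 (step G (step G S)) (le_trans (Nat.mul_le_mul_left 8 (card_le_card (sub _))) h2)
  -- Otherwise b vertices with nonpositive neighbour sums would have a nonpositive total.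
  have h6 : #{v | nbrSum G (step G (step G S)) v ≤ 0} < b := by
    by_contra! hb
    obtain ⟨B, hB, hBb⟩ := exists_subset_card_eq hb
    exact absurd (h5 B hBb) (not_lt.2 (sum_nonpos fun v hv => (mem_filter.1 (hB hv)).2))
  have h7 := (card_le_card (sub (step G (step G S)))).trans_lt h6
  change step G (step G (step G (step G S))) v = 1
  refine step_of_pos ?_
  set τ := step G (step G (step G S))
  -- Each wrong neighbour lowers the sum from the degree by 2.
  have h8 : nbrSum G 1 v - nbrSum G τ v ≤ 2 * #{v | τ v = -1} := by
    classical
    simp only [nbrSum, ← sum_sub_distrib, card_filter, Nat.cast_sum, mul_sum]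
    rw [sum_filter]
    refine sum_le_sum fun u _ => ?_
    simp only [Pi.one_apply]
    rcases Int.units_eq_one_or (τ u) with h | h <;> rw [h] <;> by_cases ha : G.Adj v u <;> simp [ha]
  have := h4 v
  omega

end MajorityDynamics

namespace MajorityDynamics

open Finset

variable {V : Type*} [Fintype V] [DecidableEq V] {p : ℝ}

/-! ### The union bound over all failures of the graph. -/

theorem four_pow_mul_exp_le {n : ℕ} (hn : 0 < n) :
    (4 : ℝ) ^ n * Real.exp (-(2 * n)) ≤ 2 / n := by
  have h1 : (9 / 5 : ℝ) * 4 ≤ Real.exp 2 := by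
    have := Real.exp_one_gt_d9
    have h : Real.exp 2 = Real.exp 1 * Real.exp 1 := by rw [← Real.exp_add]; norm_num
    rw [h]; nlinarith
  have h2 : (1 + n * (4 / 5) : ℝ) ≤ (1 + 4 / 5) ^ n :=
    one_add_mul_le_pow (by norm_num) n
  have h3 : (9 / 5 : ℝ) ^ n * 4 ^ n ≤ Real.exp (2 * n) := by
    rw [← mul_pow, mul_comm (2 : ℝ), Real.exp_nat_mul]; gcongr
  have hn' : (0 : ℝ) < n := by exact_mod_cast hn
  rw [Real.exp_neg, ← div_eq_mul_inv, div_le_div_iff₀ (Real.exp_pos _) hn']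
  have h5 : (n : ℝ) ≤ 2 * (9 / 5) ^ n := by
    norm_num at h2; linarith
  calc (4 : ℝ) ^ n * n ≤ 4 ^ n * (2 * (9 / 5) ^ n) := by gcongr
    _ = 2 * ((9 / 5) ^ n * 4 ^ n) := by ring
    _ ≤ 2 * Real.exp (2 * n) := by gcongr

theorem mul_exp_neg_le {n x : ℝ} (hn : 0 < n) (hx : 0 < x) (h : 1040 * n ≤ x ^ 2) :
    n * Real.exp (-(x / 16)) ≤ 2 / n := by
  have h1 := Real.pow_div_factorial_le_exp (x / 16) (by positivity) 4
  rw [Real.exp_neg, ← div_eq_mul_inv, div_le_div_iff₀ (Real.exp_pos _) hn]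
  have h2 : (1040 * n) ^ 2 ≤ (x ^ 2) ^ 2 := by gcongr
  have : (Nat.factorial 4 : ℝ) = 24 := by norm_num [Nat.factorial]
  rw [this] at h1
  nlinarith

/-- The states of τ sum to at least 3n/4, so t = 1/8 gives the exponent pb(1/8 - n/16). With pb ≥ 64
this is small enough to beat the 4^n pairs in the union bound. -/
theorem expect_edgeDensity_failure_le (h0 : 0 ≤ p) (h1 : p ≤ 1) {b : ℕ} (hb : 64 ≤ p * b)
    (hn : 4 ≤ Fintype.card V) {τ : V → ℤˣ} (hτ : 8 * #{v | τ v = -1} ≤ Fintype.card V)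
    {B : Finset V} (hB : #B = b) :
    expect p (allEdges V) (fun A => if ∑ v ∈ B, nbrSum (graph A) τ v ≤ 0 then 1 else 0)
      ≤ Real.exp (-(2 * Fintype.card V)) := by
  have h := expect_sum_nbrSum_le_exp h0 h1 τ B (t := 1 / 8) (by norm_num) (by norm_num) 0
  refine h.trans (Real.exp_le_exp.2 ?_)
  set n := Fintype.card V with hndef
  have hsum : 3 * (n : ℝ) / 4 ≤ (∑ u, (τ u : ℤ) : ℤ) := by
    have e1 := card_pos_add_card_neg τ univ
    have e2 := card_pos_sub_card_neg τ univ
    rw [card_univ, ← hndef] at e1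
    have : 3 * (n : ℤ) ≤ 4 * ∑ u, (τ u : ℤ) := by omega
    have : 3 * (n : ℝ) ≤ 4 * (∑ u, (τ u : ℤ) : ℤ) := by exact_mod_cast this
    linarith
  have hn' : (4 : ℝ) ≤ n := by exact_mod_cast hn
  rw [hB]
  push_cast at hsum ⊢
  have h1 : (p * b) * (3 * (n : ℝ) / 4 - 1) ≤ (p * b) * ((∑ u, ((τ u : ℤ) : ℝ)) - 1) := by
    gcongr
  nlinarith [mul_le_mul_of_nonneg_right hb (by linarith : (0 : ℝ) ≤ n)]

theorem expect_degree_failure_le (h0 : 0 ≤ p) (h1 : p ≤ 1) {b : ℕ}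
    (hb : 2 * (b : ℝ) ≤ p * Fintype.card V / 8) (hpn : 8 ≤ p * Fintype.card V) (v : V) :
    expect p (allEdges V) (fun A => if nbrSum (graph A) 1 v ≤ 2 * b then 1 else 0)
      ≤ Real.exp (-(p * Fintype.card V / 16)) := by
  have h := expect_sum_nbrSum_le_exp h0 h1 (1 : V → ℤˣ) {v} (t := 1 / 4) (by norm_num)
    (by norm_num) (2 * b)
  simp only [sum_singleton, card_singleton] at h
  refine h.trans (Real.exp_le_exp.2 ?_)
  simp only [Pi.one_apply, Units.val_one, sum_const, card_univ, nsmul_eq_mul]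
  push_cast
  linarith

theorem expect_not_state_four_le {σ : V → ℤˣ} {c : ℝ} (h0 : 0 < p) (h1 : p ≤ 1) (hc : 0 < c)
    (hc1 : c ≤ 1) (hn : 100 ≤ Fintype.card V) (hpn : 1040 ≤ p ^ 2 * Fintype.card V)
    (hD : c * √(Fintype.card V) + 2 ≤ (∑ v, (σ v : ℤ) : ℤ))
    (hD4 : 4 * (∑ v, (σ v : ℤ)) ≤ Fintype.card V)
    (hDp : 32 ≤ ((∑ v, (σ v : ℤ) : ℤ) - 2 : ℝ) * p) :
    expect p (allEdges V) (fun A => if ∀ v, state (graph A) σ 4 v = 1 then 0 else 1)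
      ≤ 5308416 / (c ^ 2 * (p ^ 2 * Fintype.card V)) + 4 / Fintype.card V := by
  classical
  have hround (v : V) := expect_second_round_le v h0 h1 hc hc1 hn hD hD4 hDp
  set n := Fintype.card V with hndef
  have hn' : (100 : ℝ) ≤ n := by exact_mod_cast hn
  -- Both demands on b ≈ 64/p are compatible because p²n ≥ 1040 = 16 · 65. The 65 absorbs the
  -- rounding up.
  obtain ⟨b, hb1, hb2⟩ : ∃ b : ℕ, 64 ≤ p * b ∧ 2 * (b : ℝ) ≤ p * n / 8 := by
    refine ⟨⌈64 / p⌉₊, ?_, ?_⟩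
    · have := Nat.le_ceil (64 / p)
      rw [div_le_iff₀ h0] at this
      linarith
    · have := (Nat.ceil_lt_add_one (by positivity : 0 ≤ 64 / p)).le
      have h64 : 64 / p + 1 ≤ 65 / p := by
        rw [div_add_one h0.ne', div_le_div_iff_of_pos_right h0]; linarith
      have h65 : 65 / p ≤ p * n / 16 := by
        rw [div_le_iff₀ h0]; nlinarith
      linarith
  have hpn8 : 1040 ≤ p * n := by
    have : p ^ 2 * n ≤ p * n := by
      rw [sq]
      have := mul_le_mul_of_nonneg_right (mul_le_of_le_one_left h0.le h1) (by linarith : (0 : ℝ) ≤ n)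
      exact this
    linarith
  set T : Finset ((V → ℤˣ) × Finset V) :=
    {x | 8 * #{v | x.1 v = -1} ≤ Fintype.card V ∧ #x.2 = b} with hT
  have hTcard : (#T : ℝ) ≤ 4 ^ n := by
    have : #T ≤ 4 ^ n := by
      refine (card_le_univ T).trans (le_of_eq ?_)
      rw [Fintype.card_prod, Fintype.card_fun, Fintype.card_finset, Fintype.card_units_int,
        ← mul_pow]
      rfl
    exact_mod_cast this
  -- The factor 8/n turns the number of vertices wrong after round two into a Markov bound for more
  -- than n/8 of them.
  have union (A : Finset (Sym2 V)) :
      (if ∀ v, state (graph A) σ 4 v = 1 then (0 : ℝ) else 1)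
        ≤ 8 / n * (∑ v, if nbrSum (graph A) (step (graph A) σ) v ≤ 0 then 1 else 0)
          + (∑ x ∈ T, if ∑ v ∈ x.2, nbrSum (graph A) x.1 v ≤ 0 then 1 else 0)
          + ∑ v, if nbrSum (graph A) 1 v ≤ 2 * b then 1 else 0 := by
    have p1 : (0 : ℝ) ≤ 8 / n * (∑ v, if nbrSum (graph A) (step (graph A) σ) v ≤ 0 then 1 else 0) :=
      mul_nonneg (by positivity) (sum_nonneg fun _ _ => by split_ifs <;> norm_num)
    have p2 : (0 : ℝ) ≤ ∑ x ∈ T, if ∑ v ∈ x.2, nbrSum (graph A) x.1 v ≤ 0 then 1 else 0 :=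
      sum_nonneg fun _ _ => by split_ifs <;> norm_num
    have p3 : (0 : ℝ) ≤ ∑ v, if nbrSum (graph A) 1 v ≤ 2 * b then 1 else 0 :=
      sum_nonneg fun _ _ => by split_ifs <;> norm_num
    split_ifs with hgood
    · linarith
    by_contra! hlt
    refine hgood (state_four_eq_one (b := b) ?_ ?_ ?_)
    · by_contra! hcon
      have h8 : (n : ℝ) ≤ 8 * (#{v | nbrSum (graph A) (step (graph A) σ) v ≤ 0} : ℕ) := by
        exact_mod_cast hcon.le
      rw [sum_boole] at p1 hlt
      have : 1 ≤ 8 / n * (#{v | nbrSum (graph A) (step (graph A) σ) v ≤ 0} : ℝ) := by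
        rw [div_mul_eq_mul_div, le_div_iff₀ (by linarith)]; linarith
      linarith
    · intro τ hτ B hB
      by_contra! hcon
      have := single_le_sum (f := fun x : (V → ℤˣ) × Finset V =>
        if ∑ v ∈ x.2, nbrSum (graph A) x.1 v ≤ 0 then (1 : ℝ) else 0)
        (fun _ _ => by split_ifs <;> norm_num)
        (show (τ, B) ∈ T from mem_filter.2 ⟨mem_univ _, hτ, hB⟩)
      rw [if_pos hcon] at this
      linarith
    · intro v
      by_contra! hcon
      have := single_le_sum (f := fun v : V => if nbrSum (graph A) 1 v ≤ 2 * b then (1 : ℝ) else 0)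
        (fun _ _ => by split_ifs <;> norm_num) (mem_univ v)
      rw [if_pos hcon] at this
      linarith
  refine (expect_mono h0.le h1 fun A _ => union A).trans ?_
  rw [expect_add, expect_add, expect_const_mul, expect_sum, expect_sum, expect_sum]
  have b1 := sum_le_card_nsmul univ _ _ fun v _ => hround v
  have b2 := sum_le_card_nsmul T _ _ fun x hx =>
    expect_edgeDensity_failure_le h0.le h1 hb1 (by omega) (mem_filter.1 hx).2.1
      (mem_filter.1 hx).2.2
  have b3 := sum_le_card_nsmul univ _ _ fun v _ =>
    expect_degree_failure_le h0.le h1 hb2 (by linarith) v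
  rw [card_univ, nsmul_eq_mul, ← hndef] at b1 b3
  rw [nsmul_eq_mul] at b2
  have c1 : 8 / (n : ℝ) * (n * (663552 / (c ^ 2 * p ^ 2 * n))) = 5308416 / (c ^ 2 * (p ^ 2 * n)) := by
    field_simp; norm_num
  have c2 := (mul_le_mul_of_nonneg_right hTcard (Real.exp_pos (-(2 * (n : ℝ)))).le).trans
    (four_pow_mul_exp_le (by omega))
  have c3 := mul_exp_neg_le (n := n) (x := p * n) (by linarith) (by linarith) (by nlinarith)
  have c4 : 2 / (n : ℝ) + 2 / n = 4 / n := by ring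
  have c5 := mul_le_mul_of_nonneg_left b1 (by positivity : (0 : ℝ) ≤ 8 / n)
  rw [c1] at c5
  linarith [b2.trans c2, b3.trans c3]

end MajorityDynamics

namespace MajorityDynamics

open Finset

/-! ### The initial configuration -/

theorem isAveraging_shift (k : ℤ) : IsAveraging (shift k) where
  mono _ _ H x := H (x + k)
  const _ := rfl

/-- For p = 1/2 a {0,1}-step is a translated {0,-1}-step. Trading half the steps lets the pairing
into a lazy walk apply to a plain binomial variable. -/
theorem up_half_pow_point_le (n : ℕ) (k x : ℤ) :
    (up (1 / 2) ^ n) (point k) x ≤ lazyWalk (1 / 4) (n / 2) 0 := by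
  have h : up (1 / 2) = shift 1 * down (1 / 2) := by
    ext φ x
    simp only [Module.End.mul_apply, up_apply, down_apply, shift_apply, add_sub_cancel_right]
    ring
  have hc : Commute (shift 1) (down (1 / 2)) := by
    have := up_pow_mul_down_pow_commute_shift (1 / 2) 0 1 1
    simpa using this.symm
  have e : up (1 / 2) ^ n
      = shift 1 ^ (n / 2) * (up (1 / 2) ^ (n - n / 2) * down (1 / 2) ^ (n / 2)) := by
    conv_lhs => rw [show n = (n - n / 2) + n / 2 by omega, pow_add]
    nth_rewrite 2 [h]
    rw [hc.mul_pow, ← mul_assoc, ← mul_assoc, ((commute_up_shift (1 / 2) 1).pow_pow _ _).eq]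
  rw [e, Module.End.mul_apply]
  refine ((isAveraging_shift 1).pow _).le_of_le (fun y => ?_) x
  have := up_pow_down_pow_point_le (p := 1 / 2) (by norm_num) (by norm_num)
    (show n / 2 ≤ n - n / 2 by omega) le_rfl k y
  norm_num at this ⊢
  exact this

theorem lazyWalk_quarter_le {n : ℕ} (hn : 2 ≤ n) : lazyWalk (1 / 4) (n / 2) 0 ≤ 5 / 2 / √n := by
  have h := lazyWalk_zero_sq_le (q := 1 / 4) (by norm_num) (by norm_num) (n / 2)
  have h3 : (n : ℝ) / 3 ≤ (n / 2 : ℕ) := by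
    rw [div_le_iff₀ (by norm_num)]
    exact_mod_cast (by omega : n ≤ n / 2 * 3)
  have hn' : (0 : ℝ) < n := by exact_mod_cast (by omega : 0 < n)
  have hs : 0 < √(n : ℝ) := Real.sqrt_pos.2 hn'
  rw [le_div_iff₀ hs]
  refine le_of_sq_le_sq ?_ (by norm_num)
  rw [mul_pow, Real.sq_sqrt hn'.le]
  nlinarith [mul_le_mul_of_nonneg_right h3 (sq_nonneg (lazyWalk (1 / 4) (n / 2) 0))]

variable {V : Type*} [Fintype V] [DecidableEq V]

theorem expect_half_card (φ : ℤ → ℝ) :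
    expect (1 / 2) (univ : Finset V) (fun A => φ #A) = (up (1 / 2) ^ Fintype.card V) φ 0 := by
  have := expect_signed_sum (p := 1 / 2) (univ : Finset V) 1 φ 0
  simpa [show (1 : ℤˣ) ≠ -1 by decide] using this

/-- The initial majority is typically of order `√n`. -/
theorem expect_initial_failure_le {c : ℝ} (hc : 0 ≤ c) (hn : 2 ≤ Fintype.card V) :
    expect (1 / 2) (univ : Finset V) (fun A =>
        if c * √(Fintype.card V) + 2 ≤ |2 * (#A : ℝ) - Fintype.card V|
          ∧ 4 * |2 * (#A : ℝ) - Fintype.card V| ≤ Fintype.card V then 0 else 1)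
      ≤ 5 / 2 * c + 15 / 2 / √(Fintype.card V) + 16 / Fintype.card V := by
  set n := Fintype.card V with hndef
  have hn' : (0 : ℝ) < n := by exact_mod_cast (by omega : 0 < n)
  have hs : 0 < √(n : ℝ) := Real.sqrt_pos.2 hn'
  set r := c * √n + 2 with hr
  have hr0 : 0 < r := by positivity
  -- J contains the sizes of the plus set for which the majority is too small. There are at most r +
  -- 1 of them, each of probability O(1/√n). Too large a majority is handled by Chebyshev.
  set J : Finset ℤ := Icc ⌈((n : ℝ) - r) / 2⌉ ⌊((n : ℝ) + r) / 2⌋ with hJ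
  have hJcard : (#J : ℝ) ≤ r + 1 := by
    have h1 := Int.le_ceil (((n : ℝ) - r) / 2)
    have h2 := Int.floor_le (((n : ℝ) + r) / 2)
    rw [hJ, Int.card_Icc]
    rcases le_total 0 (⌊((n : ℝ) + r) / 2⌋ + 1 - ⌈((n : ℝ) - r) / 2⌉) with h | h
    · have : (((⌊((n : ℝ) + r) / 2⌋ + 1 - ⌈((n : ℝ) - r) / 2⌉).toNat : ℤ) : ℝ)
          = ⌊((n : ℝ) + r) / 2⌋ + 1 - ⌈((n : ℝ) - r) / 2⌉ := by
        rw [Int.toNat_of_nonneg h]; push_cast; ring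
      rw [Int.cast_natCast] at this
      rw [this]; linarith
    · rw [Int.toNat_of_nonpos h]; push_cast; linarith
  have hpt (A : Finset V) :
      (if r ≤ |2 * (#A : ℝ) - n| ∧ 4 * |2 * (#A : ℝ) - n| ≤ n then (0 : ℝ) else 1)
        ≤ (∑ j ∈ J, point j #A) + 64 / n ^ 2 * (((#A : ℤ) : ℝ) - n * (1 / 2)) ^ 2 := by
    have p1 : 0 ≤ ∑ j ∈ J, point j #A :=
      sum_nonneg fun _ _ => by unfold point; split_ifs <;> norm_num
    have p2 : 0 ≤ 64 / (n : ℝ) ^ 2 * (((#A : ℤ) : ℝ) - n * (1 / 2)) ^ 2 := by positivity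
    split_ifs with h
    · linarith
    · rw [not_and_or, not_le, not_le] at h
      rcases h with h | h
      · rw [abs_lt] at h
        have hmem : (#A : ℤ) ∈ J := by
          rw [hJ, mem_Icc, Int.ceil_le, Int.le_floor]
          push_cast
          constructor <;> linarith [h.1, h.2]
        have : 1 ≤ ∑ j ∈ J, point j #A := by
          refine le_trans (by simp [point]) (single_le_sum (f := fun j => point j #A)
            (fun _ _ => by unfold point; split_ifs <;> norm_num) hmem)
        linarith
      · have : 1 ≤ 64 / (n : ℝ) ^ 2 * (((#A : ℤ) : ℝ) - n * (1 / 2)) ^ 2 := by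
          rw [div_mul_eq_mul_div, le_div_iff₀ (by positivity), one_mul]
          have h2 : (n : ℝ) ^ 2 ≤ (4 * |2 * (#A : ℝ) - n|) ^ 2 := by gcongr
          rw [mul_pow, sq_abs] at h2
          push_cast
          nlinarith
        linarith
  refine (expect_mono (by norm_num) (by norm_num) fun A _ => hpt A).trans ?_
  rw [expect_add, expect_sum, expect_const_mul,
    expect_half_card fun x => ((x : ℝ) - n * (1 / 2)) ^ 2, ← hndef, up_pow_sq]
  have h1 : ∑ j ∈ J, expect (1 / 2) (univ : Finset V) (fun A => point j #A)
      ≤ #J * (5 / 2 / √n) := by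
    rw [← nsmul_eq_mul]
    refine sum_le_card_nsmul _ _ _ fun j _ => ?_
    rw [expect_half_card]
    exact (up_half_pow_point_le _ _ _).trans (lazyWalk_quarter_le hn)
  have h2 : (#J : ℝ) * (5 / 2 / √n) ≤ (r + 1) * (5 / 2 / √n) := by gcongr
  have h3 : (r + 1) * (5 / 2 / √n) = 5 / 2 * c + 15 / 2 / √n := by
    rw [hr]; field_simp; ring
  have h4 : 64 / (n : ℝ) ^ 2 * (n * (1 / 2 * (1 - 1 / 2))) = 16 / n := by
    field_simp; norm_num
  rw [h4]
  linarith

/-! ### Translation to measures -/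

open MeasureTheory ProbabilityTheory

instance : MeasurableSingletonClass ℤˣ where
  measurableSet_singleton u := ⟨{(u : ℤ)}, measurableSet_singleton _, by ext; simp [Units.ext_iff]⟩

instance : MeasurableSingletonClass (SimpleGraph V) where
  measurableSet_singleton G :=
    ⟨{G.Adj}, measurableSet_singleton _, by ext; simp⟩

/-- A uniform configuration is encoded by its set of plus vertices, a binomial random set with
parameter 1/2. -/
theorem uniformOn_real_eq_expect (P : (V → ℤˣ) → Prop) [DecidablePred P] :
    (uniformOn (Set.univ : Set (V → ℤˣ))).real {σ | P σ}
      = expect (1 / 2) (univ : Finset V)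
          (fun A => if P (fun v => if v ∈ A then 1 else -1) then 1 else 0) := by
  have hbij : Function.Bijective fun (A : Finset V) (v : V) => if v ∈ A then (1 : ℤˣ) else -1 := by
    refine ⟨fun A B h => ?_, fun σ => ⟨({v | σ v = 1} : Finset V), ?_⟩⟩
    · ext v
      have := congrFun h v
      by_cases h1 : v ∈ A <;> by_cases h2 : v ∈ B <;> simp_all
    · ext1 v
      rcases Int.units_eq_one_or (σ v) with h | h <;> simp [h]
  have hsum : ∑ A : Finset V, (if P (fun v => if v ∈ A then 1 else -1) then (1 : ℝ) else 0)
      = #{σ | P σ} := by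
    rw [card_filter, Nat.cast_sum]
    push_cast
    exact hbij.sum_comp fun σ => if P σ then (1 : ℝ) else 0
  have hexp : expect (1 / 2) (univ : Finset V)
      (fun A => if P (fun v => if v ∈ A then 1 else -1) then 1 else 0)
      = (1 / 2) ^ Fintype.card V
        * ∑ A : Finset V, (if P (fun v => if v ∈ A then 1 else -1) then (1 : ℝ) else 0) := by
    rw [expect, powerset_univ, mul_sum]
    refine sum_congr rfl fun A _ => ?_
    congr 1
    rw [show (1 - 1 / 2 : ℝ) = 1 / 2 by norm_num, ← pow_add, add_comm,
      card_sdiff_add_card_eq_card (subset_univ A), card_univ]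
  have hset : {σ | P σ} = ((({σ | P σ} : Finset (V → ℤˣ))) : Set (V → ℤˣ)) := by ext; simp
  rw [hexp, hsum, measureReal_def, uniformOn_univ, hset, Measure.count_apply_finset,
    ENNReal.toReal_div]
  simp [div_eq_inv_mul]

/-- Each graph is `graph A` for exactly one loopless edge set A, and its mass is the weight of A in
`expect`. -/
theorem binomialRandom_real_eq_expect (p : unitInterval) (P : SimpleGraph V → Prop)
    [DecidablePred P] :
    (SimpleGraph.binomialRandom V p).real {G | P G}
      = expect p (allEdges V) (fun A => if P (graph A) then 1 else 0) := by
  classical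
  have hsing (A : Finset (Sym2 V)) (hA : A ⊆ allEdges V) :
      (SimpleGraph.binomialRandom V p).real {graph A}
        = (p : ℝ) ^ #A * (1 - p) ^ #(allEdges V \ A) := by
    have hdiag : (Sym2.diagSetᶜ : Set (Sym2 V)) = allEdges V := by
      ext e; simp [allEdges]
    have hedge : (graph A).edgeSet = A := by
      rw [graph, SimpleGraph.edgeSet_fromEdgeSet, sdiff_eq_left, Set.disjoint_left]
      intro e he
      have := hA he
      simpa [allEdges] using this
    rw [measureReal_def, SimpleGraph.binomialRandom_apply', Set.image_singleton, hedge,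
      ← measureReal_def, hdiag, setBernoulli_real_singleton _ (by exact_mod_cast hA)
        (Finset.finite_toSet _), ← coe_sdiff, Set.ncard_coe_finset, Set.ncard_coe_finset]
  have hset : {G | P G} = ((({A ∈ (allEdges V).powerset | P (graph A)}).image graph
      : Finset (SimpleGraph V)) : Set (SimpleGraph V)) := by
    ext G
    simp only [Set.mem_ofPred_eq, coe_image, Set.mem_image, mem_coe, mem_filter, mem_powerset]
    constructor
    · intro h
      have hG : graph G.edgeFinset = G := by simp [graph]
      refine ⟨G.edgeFinset, ⟨fun e he => ?_, by rwa [hG]⟩, hG⟩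
      simp only [allEdges, mem_filter, mem_univ, true_and]
      exact G.not_isDiag_of_mem_edgeFinset he
    · rintro ⟨A, ⟨-, hA⟩, rfl⟩
      exact hA
  rw [hset, ← sum_measureReal_singleton, sum_image, sum_filter, expect]
  · refine sum_congr rfl fun A hA => ?_
    rw [mul_ite, mul_one, mul_zero, hsing A (mem_powerset.1 hA)]
  · intro A hA B hB h
    have hA := mem_powerset.1 (mem_filter.1 hA).1
    have hB := mem_powerset.1 (mem_filter.1 hB).1
    ext e
    induction e with
    | _ x y =>
      have h1 := congrArg (fun G : SimpleGraph V => G.Adj x y) h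
      simp only [graph_adj, eq_iff_iff] at h1
      constructor
      · intro he
        exact (h1.1 ⟨he, by simpa [allEdges] using hA he⟩).1
      · intro he
        exact (h1.2 ⟨he, by simpa [allEdges] using hB he⟩).1

end MajorityDynamics

namespace MajorityDynamics

open Finset MeasureTheory ProbabilityTheory

/-! ### Combining the random graph with the random initial configuration. -/

/-- Given a clear initial majority, the random graph leads to unanimity in four rounds. -/
theorem binomialRandom_not_unanimous_le {n : ℕ} {p : unitInterval} {σ : Fin n → ℤˣ} {c : ℝ}
    (h0 : 0 < (p : ℝ)) (hc : 0 < c) (hc1 : c ≤ 1) (hn : 100 ≤ n)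
    (hpn : 1040 ≤ (p : ℝ) ^ 2 * n) (hcp : 32 ≤ c * √n * p)
    (hD : c * √n + 2 ≤ |((∑ v, (σ v : ℤ) : ℤ) : ℝ)|)
    (hD4 : 4 * |((∑ v, (σ v : ℤ) : ℤ) : ℝ)| ≤ n) :
    (SimpleGraph.binomialRandom (Fin n) p).real {G | (G, σ) ∉ unanimous n 4}
      ≤ 5308416 / (c ^ 2 * ((p : ℝ) ^ 2 * n)) + 4 / n := by
  classical
  -- by symmetry the majority may be assumed to be positive
  have main (τ : Fin n → ℤˣ) (hpos : 0 ≤ ((∑ v, (τ v : ℤ) : ℤ) : ℝ))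
      (hD : c * √n + 2 ≤ |((∑ v, (τ v : ℤ) : ℤ) : ℝ)|)
      (hD4 : 4 * |((∑ v, (τ v : ℤ) : ℤ) : ℝ)| ≤ n) :
      (SimpleGraph.binomialRandom (Fin n) p).real {G | (G, τ) ∉ unanimous n 4}
        ≤ 5308416 / (c ^ 2 * ((p : ℝ) ^ 2 * n)) + 4 / n := by
    rw [abs_of_nonneg hpos] at hD hD4
    have hDpos : 0 < ∑ v, (τ v : ℤ) := by
      have : (0 : ℝ) < (∑ v, (τ v : ℤ) : ℤ) := by
        have : 0 ≤ c * √n := by positivity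
        linarith
      exact_mod_cast this
    have key := expect_not_state_four_le (p := (p : ℝ)) (σ := τ) h0 p.2.2 hc hc1 (by simpa using hn)
      (by simpa using hpn) (by simpa using hD)
      (by rw [Fintype.card_fin]; exact_mod_cast hD4)
      (hcp.trans (by gcongr; linarith))
    rw [Fintype.card_fin] at key
    rw [binomialRandom_real_eq_expect]
    refine le_trans (le_of_eq (expect_congr fun A _ => ?_)) key
    have hiff : (graph A, τ) ∉ unanimous n 4 ↔ ¬∀ v, state (graph A) τ 4 v = 1 := by
      simp only [unanimous, Set.mem_ofPred_eq, sgn, if_neg hDpos.not_gt, ne_eq, hDpos.ne',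
        not_false_eq_true, true_and]
    simp only [hiff, ite_not]
    congr
  rcases le_total 0 ((∑ v, (σ v : ℤ) : ℤ) : ℝ) with hpos | hneg
  · exact main σ hpos hD hD4
  · have hsum : ∑ v, ((-σ) v : ℤ) = -∑ v, (σ v : ℤ) := by simp
    have := main (-σ) (by rw [hsum]; push_cast at hneg ⊢; linarith)
      (by rw [hsum, Int.cast_neg, abs_neg]; exact hD)
      (by rw [hsum, Int.cast_neg, abs_neg]; exact hD4)
    have hset : {G | (G, -σ) ∉ unanimous n 4} = {G | (G, σ) ∉ unanimous n 4} := by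
      ext G
      simp only [Set.mem_ofPred_eq, unanimous, state_neg, Pi.neg_apply, not_iff_not, ne_eq,
        Units.val_neg, sum_neg_distrib, neg_eq_zero]
      refine and_congr_right fun h => forall_congr' fun v => ?_
      have : sgn (-∑ v, (σ v : ℤ)) = -sgn (∑ v, (σ v : ℤ)) := by
        simp only [sgn]
        split_ifs <;> first | omega | simp
      rw [this, neg_inj]
    rwa [hset] at this

end MajorityDynamics

theorem theorem1p1 :
    ∀ ε : ℝ, 0 < ε → ε ≤ 1 →
      ∃ l : ℝ, 0 < l ∧ ∃ n₀ : ℕ, ∀ n : ℕ, n₀ < n →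
        ∀ p : unitInterval, l * (n : ℝ) ^ (-(1 / 2) : ℝ) ≤ (p : ℝ) →
          1 - ε ≤ (MajorityDynamics.law n p).real (MajorityDynamics.unanimous n 4) := by
  classical
  intro ε hε hε1
  -- With c = ε/20 the main term 5c/2 of the initial failure bound is ε/8. As 4608² = 4 · 5308416,
  -- the choice of l makes the main term of the graph failure at most ε²/4.
  obtain ⟨c, hc⟩ : ∃ c : ℝ, c = ε / 20 := ⟨_, rfl⟩
  obtain ⟨l, hl⟩ : ∃ l : ℝ, l = 4608 / (c * ε) := ⟨_, rfl⟩
  have hc0 : 0 < c := by rw [hc]; positivity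
  have hc1 : c ≤ 1 := by linarith
  have hl0 : 0 < l := by rw [hl]; positivity
  refine ⟨l, hl0, ⌈40000 / ε ^ 2⌉₊, fun n hn p hp => ?_⟩
  have hnε : 40000 / ε ^ 2 ≤ n := (Nat.le_ceil _).trans (by exact_mod_cast hn.le)
  have hn40000 : (40000 : ℝ) ≤ n := by
    refine le_trans ?_ hnε
    rw [le_div_iff₀ (by positivity)]
    nlinarith
  have hn100 : 100 ≤ n := by
    have : (100 : ℝ) ≤ n := by linarith
    exact_mod_cast this
  have hn0 : (0 : ℝ) < n := by linarith
  have hs0 : 0 < √(n : ℝ) := Real.sqrt_pos.2 hn0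
  have hss : √(n : ℝ) ^ 2 = n := Real.sq_sqrt hn0.le
  have hsε : 200 / ε ≤ √n := by
    refine Real.le_sqrt_of_sq_le ?_
    rw [div_pow]; norm_num; exact hnε
  have hps : l ≤ p * √n := by
    rw [Real.rpow_neg hn0.le, ← Real.sqrt_eq_rpow, ← div_eq_mul_inv, div_le_iff₀ hs0] at hp
    exact hp
  have hp0 : 0 < (p : ℝ) := by
    by_contra! h
    nlinarith
  have hpn : l ^ 2 ≤ (p : ℝ) ^ 2 * n := by
    rw [← hss, ← mul_pow]; gcongr
  have hcl : c * l * ε = 4608 := by rw [hl]; field_simp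
  have hcl' : 4608 ≤ c * l := by nlinarith [mul_pos hc0 hl0]
  have hl1 : 4608 ≤ l := by nlinarith
  have hpn1 : 1040 ≤ (p : ℝ) ^ 2 * n := by nlinarith
  have hcp : 32 ≤ c * √n * p := by nlinarith
  set ν := ProbabilityTheory.uniformOn (Set.univ : Set (Fin n → ℤˣ)) with hν
  set μ := SimpleGraph.binomialRandom (Fin n) p with hμ
  set Q : (Fin n → ℤˣ) → Prop := fun σ => c * √n + 2 ≤ |((∑ v, (σ v : ℤ) : ℤ) : ℝ)| ∧
    4 * |((∑ v, (σ v : ℤ) : ℤ) : ℝ)| ≤ n with hQ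
  set δ := 5308416 / (c ^ 2 * ((p : ℝ) ^ 2 * n)) + 4 / n with hδ
  have hδ0 : 0 ≤ δ := by positivity
  have hfour : 4 / (n : ℝ) ≤ ε / 8 := by
    rw [div_le_iff₀ hn0]
    have : 40000 ≤ n * ε ^ 2 := by rwa [div_le_iff₀ (by positivity)] at hnε
    nlinarith [mul_pos hn0 hε]
  have hδε : δ ≤ 3 * ε / 8 := by
    have : 5308416 / (c ^ 2 * ((p : ℝ) ^ 2 * n)) ≤ ε / 4 := by
      rw [div_le_iff₀ (by positivity)]
      have h1 : c ^ 2 * l ^ 2 ≤ c ^ 2 * ((p : ℝ) ^ 2 * n) := by gcongr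
      have h2 : c ^ 2 * l ^ 2 * ε ^ 2 = 4608 ^ 2 := by rw [← hcl]; ring
      have h3 : c ^ 2 * l ^ 2 * ε ^ 2 ≤ c ^ 2 * ((p : ℝ) ^ 2 * n) * ε := by
        have : ε ^ 2 ≤ ε := by nlinarith
        gcongr
      linarith
    linarith
  have hinit : ν.real {σ | ¬Q σ} ≤ ε / 2 := by
    have h := MajorityDynamics.expect_initial_failure_le (V := Fin n) hc0.le (by simp; omega)
    rw [Fintype.card_fin] at h
    rw [hν, MajorityDynamics.uniformOn_real_eq_expect]
    have hsum (A : Finset (Fin n)) :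
        ((∑ v, (((if v ∈ A then 1 else -1 : ℤˣ)) : ℤ) : ℤ) : ℝ) = 2 * (A.card : ℝ) - n := by
      have : ∀ v, (((if v ∈ A then 1 else -1 : ℤˣ)) : ℤ) = 2 * (if v ∈ A then 1 else 0) - 1 := by
        intro v; split_ifs <;> simp
      simp only [this, Finset.sum_sub_distrib, ← Finset.mul_sum]
      simp
    have hfail : 15 / 2 / √(n : ℝ) ≤ ε / 16 := by
      rw [div_le_iff₀ hs0]
      rw [div_le_iff₀ hε] at hsε
      linarith
    have h16 : 16 / (n : ℝ) = 4 * (4 / n) := by ring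
    have hle16 : 16 / (n : ℝ) ≤ ε / 16 := by
      rw [div_le_iff₀ hn0]
      have : 40000 ≤ n * ε ^ 2 := by rwa [div_le_iff₀ (by positivity)] at hnε
      nlinarith [mul_pos hn0 hε]
    refine le_trans (le_of_eq (MajorityDynamics.expect_congr fun A _ => ?_)) (h.trans (by linarith))
    simp only [hQ, hsum, ite_not]
  have hgraph (σ : Fin n → ℤˣ) (hσ : Q σ) :
      μ {G | (G, σ) ∉ MajorityDynamics.unanimous n 4} ≤ ENNReal.ofReal δ := by
    rw [← ENNReal.ofReal_toReal (MeasureTheory.measure_ne_top μ _)]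
    exact ENNReal.ofReal_le_ofReal (MajorityDynamics.binomialRandom_not_unanimous_le hp0 hc0 hc1
      hn100 hpn1 hcp hσ.1 hσ.2)
  have hcompl : (MajorityDynamics.law n p) (MajorityDynamics.unanimous n 4)ᶜ
      ≤ ENNReal.ofReal (ε / 2 + δ) := by
    -- Fubini: condition on σ, bounding the inner probability by 1 on atypical σ and by δ on typical
    -- ones.
    rw [MajorityDynamics.law, MeasureTheory.Measure.prod_apply_symm (Set.toFinite _).measurableSet]
    calc ∫⁻ σ, μ ((fun G => (G, σ)) ⁻¹' (MajorityDynamics.unanimous n 4)ᶜ) ∂ν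
        ≤ ∫⁻ σ, (({σ | ¬Q σ} : Set (Fin n → ℤˣ)).indicator 1 σ + ENNReal.ofReal δ) ∂ν := by
          refine MeasureTheory.lintegral_mono fun σ => ?_
          by_cases hσ : Q σ
          · exact le_add_left (hgraph σ hσ)
          · rw [Set.indicator_of_mem (by exact hσ)]
            exact le_add_right MeasureTheory.prob_le_one
      _ = ν {σ | ¬Q σ} + ENNReal.ofReal δ := by
          rw [MeasureTheory.lintegral_add_right _ measurable_const,
            MeasureTheory.lintegral_indicator_one (Set.toFinite _).measurableSet,
            MeasureTheory.lintegral_const, MeasureTheory.measure_univ, mul_one]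
      _ ≤ ENNReal.ofReal (ε / 2 + δ) := by
          rw [ENNReal.ofReal_add (by positivity) hδ0]
          gcongr
          rw [← ENNReal.ofReal_toReal (MeasureTheory.measure_ne_top ν _)]
          exact ENNReal.ofReal_le_ofReal hinit
  have : MeasureTheory.IsProbabilityMeasure (MajorityDynamics.law n p) := by
    unfold MajorityDynamics.law; infer_instance
  have h1 := MeasureTheory.probReal_compl_eq_one_sub (μ := MajorityDynamics.law n p)
    (Set.toFinite (MajorityDynamics.unanimous n 4)).measurableSet
  have h2 : (MajorityDynamics.law n p).real (MajorityDynamics.unanimous n 4)ᶜ ≤ ε / 2 + δ :=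
    ENNReal.toReal_le_of_le_ofReal (by positivity) hcompl
  linarith
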